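/- **Setting.** Let $\mathbb F_q$ be a finite field, $0<k<n$, and let $\mathcal G_q(n,k)$ be the set of $k$-dimensional subspaces of $\mathbb F_q^n$. Field elements are identified with the digits $0,\dots,q-1$ by any fixed bijection. For $X\in\mathcal G_q(n,k)$ let $\mathrm{RE}(X)$ be its $k\times n$ generator matrix in reduced row echelon form. The Ferrers tableaux form of $X$ is obtained from $\mathrm{RE}(X)$ by deleting the columns that contain the leading coefficients and keeping, in each row, the entries to the right of the leading coefficient. The Ferrers diagram $\mathcal F_X=(\mathcal F_{n-k},\dots,\mathcal F_1)$ is given by the numbers $\mathcal F_j$ of remaining entries (dots) in the columns, which are numbered from right to left; put $|\mathcal F_X|=\sum_j\mathcal F_j$ and $\mathcal F_0=k$. The entries vector $x=(x_1,x_2,\dots,x_{|\mathcal F_X|})$ lists the entries column by column from right to left, each column from top to bottom, and $\{x\}$ is its value as a base-$q$ number with most significant digit $x_1$. Order $\mathcal G_q(n,k)$ by $X<Y$ if $|\mathcal F_X|>|\mathcal F_Y|$; or $|\mathcal F_X|=|\mathcal F_Y|$ and, in the least column where the two diagrams differ, $\mathcal F_X$ has more dots; or $\mathcal F_X=\mathcal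 F_Y$ and $\{x\}<\{y\}$. Let $\mathrm{Ind}_{\mathcal F}(X)$ be the number of $Y\in\mathcal G_q(n,k)$ with $Y<X$. Let $p(a,\eta,m)$ be the number of partitions of $m$ whose Ferrers diagram fits in an $a\times\eta$ box (it is $0$ for $m<0$). **Theorem.** For every $X\in\mathcal G_q(n,k)$, $$\mathrm{Ind}_{\mathcal F}(X)=\sum_{i=|\mathcal F_X|+1}^{k(n-k)}p(k,n-k,i)\,q^{i}+\{x\}+q^{|\mathcal F_X|}\sum_{j=1}^{n-k}\ \sum_{a=\mathcal F_j+1}^{\mathcal F_{j-1}}p\Bigl(a,\,n-k-j,\,|\mathcal F_X|-\sum_{i=1}^{j-1}\mathcal F_i-a\Bigr),$$ and the base-$q$ digits of this number can be computed from the Ferrers tableaux form of $X$ (that is, from $k$, $n$, $\mathcal F_1,\dots,\mathcal F_{n-k}$ and $x$) with $O\bigl(k^{5/2}(n-k)^{5/2}\bigr)$ digit operations. More precisely, there are one program, the same for all $q,n,k,X$, and one absolute constant $C$ such that the program performs at most $C\,k^{5/2}(n-k)^{5/2}$ steps. The program runs on a machine with arrays of $q$-ary digits, a carry flag, and counters and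 arrays of counters that hold natural numbers; an array cell is addressed by a fixed-length tuple of counters, and all memory other than the input is initially $0$. The steps are: setting or copying a digit; adding two digits and the carry; testing a digit for zero; clearing or testing the carry; setting a counter to zero; copying, loading, storing, incrementing, (truncated) subtracting and comparing counters; doing nothing; and entering, or making one pass through, a loop whose number of passes is the value of a counter on entry. Every step counts, also those that only do bookkeeping on counters. -/

import Mathlib

/-! ### The Grassmannian, reduced row echelon forms and Ferrers tableaux forms -/

namespace FerrersCoding

/-- The Grassmannian: all `k`-dimensional subspaces of `F ^ n`. -/
def Gr (F : Type*) [Field F] (n k : ℕ) : Type _ :=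
  {X : Submodule F (Fin n → F) // Module.finrank F X = k}

/-- `RE(X)`: the unique `k × n` matrix in reduced row echelon form whose rows span `X`
(for `dim X = k` the rows form a basis, so no row is zero). -/
noncomputable def RE {F : Type*} [Field F] {n k : ℕ} (X : Gr F n k) :
    Matrix (Fin k) (Fin n) F :=
  Classical.epsilon fun A : Matrix (Fin k) (Fin n) F =>
    A.IsReducedRowEchelon ∧ Submodule.span F (Set.range fun i => A i) = X.1

open Classical in
/-- The columns of `A` without a leading coefficient, listed from right to left. These are the
columns that remain in the Ferrers tableaux form. -/
noncomputable def freeColumns {F : Type*} [Field F] {n k : ℕ} (A : Matrix (Fin k) (Fin n) F) :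
    List (Fin n) :=
  (List.finRange n).reverse.filter fun c => ¬ ∃ i, A.IsLeadingEntry i c

open Classical in
/-- The rows, from top to bottom, whose entry in column `c` lies to the right of the leading
coefficient of the row. -/
noncomputable def rowsWithDot {F : Type*} [Field F] {n k : ℕ} (A : Matrix (Fin k) (Fin n) F)
    (c : Fin n) : List (Fin k) :=
  (List.finRange k).filter fun i => ∃ c' < c, A.IsLeadingEntry i c'

/-- The Ferrers diagram `F_X` of `X`, as the list `[F_1, F_2, …, F_{n-k}]` of the numbers of dots
in its columns, the columns being numbered from right to left. -/
noncomputable def diagram {F : Type*} [Field F] {n k : ℕ} (X : Gr F n k) : List ℕ :=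
  (freeColumns (RE X)).map fun c => (rowsWithDot (RE X) c).length

/-- The entries vector `x = [x_1, x_2, …]` of the Ferrers tableaux form of `X`: the entries
are read column by column from right to left, each column from top to bottom. -/
noncomputable def entries {F : Type*} [Field F] {n k : ℕ} (X : Gr F n k) : List F :=
  (freeColumns (RE X)).flatMap fun c => (rowsWithDot (RE X) c).map fun i => RE X i c

/-- `|F_X|`, the number of dots. -/
noncomputable def size {F : Type*} [Field F] {n k : ℕ} (X : Gr F n k) : ℕ :=
  (diagram X).sum

/-- `{x}`: the value of `x = [x_1, …, x_r]` as a number in base `q`, where `x_1` is the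
most significant digit and field elements are read as digits through `e`. -/
def value {F : Type*} {q : ℕ} (e : F ≃ Fin q) (x : List F) : ℕ :=
  Nat.ofDigits q (x.map fun a => (e a : ℕ)).reverse

/-! ### The order on the Grassmannian and the lexicographic index -/

/-- The order of Ferrers diagrams of the same size: in the least column where they differ,
the smaller diagram has more dots. -/
def DiagramLT (D E : List ℕ) : Prop :=
  ∃ i, (∀ j < i, D.getD j 0 = E.getD j 0) ∧ E.getD i 0 < D.getD i 0

/-- The order `X < Y` of the Grassmannian based on the Ferrers tableaux form. -/
def Precedes {F : Type*} [Field F] {n k q : ℕ} (e : F ≃ Fin q) (X Y : Gr F n k) : Prop :=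
  size Y < size X ∨
  (size X = size Y ∧ DiagramLT (diagram X) (diagram Y)) ∨
  (diagram X = diagram Y ∧ value e (entries X) < value e (entries Y))

/-- The lexicographic index `Ind_F(X)`: the number of subspaces preceding `X`. -/
noncomputable def Ind {F : Type*} [Field F] {n k q : ℕ} (e : F ≃ Fin q) (X : Gr F n k) : ℕ :=
  Nat.card {Y : Gr F n k // Precedes e Y X}

/-- `p(a, η, m)`: the number of partitions of `m` whose Ferrers diagram fits in an `a × η` box,
i.e. with at most `a` parts, all of them at most `η`; it is `0` for negative `m`. -/
def boxPartitions (a η : ℕ) (m : ℤ) : ℕ :=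
  if 0 ≤ m then
    (Finset.univ.filter fun π : Nat.Partition m.toNat =>
      π.parts.card ≤ a ∧ ∀ b ∈ π.parts, b ≤ η).card
  else 0

/-- `F_j`, the number of dots in column `j` for `1 ≤ j ≤ n - k`, with `F_0 = k`. -/
noncomputable def column {F : Type*} [Field F] {n k : ℕ} (X : Gr F n k) (j : ℕ) : ℕ :=
  if j = 0 then k else (diagram X).getD (j - 1) 0

/-- The explicit expression of the index through the numbers `p(a, η, m)`. -/
noncomputable def indexFormula {F : Type*} [Field F] {n k q : ℕ} (e : F ≃ Fin q)
    (X : Gr F n k) : ℕ :=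
  ∑ i ∈ Finset.Icc (size X + 1) (k * (n - k)), boxPartitions k (n - k) i * q ^ i
    + value e (entries X)
    + q ^ size X * ∑ j ∈ Finset.Icc 1 (n - k),
        ∑ a ∈ Finset.Icc (column X j + 1) (column X (j - 1)),
          boxPartitions a (n - k - j)
            ((size X : ℤ) - ∑ i ∈ Finset.Icc 1 (j - 1), (column X i : ℤ) - (a : ℤ))

/-! ### A machine with `q`-ary digits

The machine has counters (natural numbers), arrays of counters, arrays of `q`-ary digits and a
carry flag. The only way to increase a number is to count up by one, so after `T` steps no
counter exceeds the largest number in the input by more than `T`; in particular arithmetic with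
long integers has to be carried out digit by digit. A program is a fixed text that knows
neither `q` nor the dimensions. -/

/-- An array cell, addressed by the number of the array and a fixed tuple of counters that
hold its subscripts. -/
structure Cell where
  /-- the number of the array -/
  array : ℕ
  /-- the counters whose contents are the subscripts -/
  subscripts : List ℕ

/-- Programs. -/
inductive Prog : Type
  /-- do nothing -/
  | skip : Prog
  /-- first the one, then the other -/
  | seq : Prog → Prog → Prog
  /-- `x := 0` -/
  | zero (x : ℕ) : Prog
  /-- `x := y` -/
  | copy (x y : ℕ) : Prog
  /-- `x := x + 1` -/
  | succ (x : ℕ) : Prog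
  /-- `x := y - z` (truncated) -/
  | sub (x y z : ℕ) : Prog
  /-- `x := T[…]` for a cell of an array of counters -/
  | load (x : ℕ) (T : Cell) : Prog
  /-- `T[…] := x` for a cell of an array of counters -/
  | store (T : Cell) (x : ℕ) : Prog
  /-- digit operation `D[…] := 0` -/
  | digitZero (D : Cell) : Prog
  /-- digit operation `D[…] := 1` -/
  | digitOne (D : Cell) : Prog
  /-- digit operation `D[…] := D'[…]` -/
  | digitCopy (D D' : Cell) : Prog
  /-- digit operation: add the digits in `D'[…]` and `D''[…]` and the carry, put the resulting
  digit in `D[…]` and keep the new carry -/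
  | digitAdd (D D' D'' : Cell) : Prog
  /-- clear the carry -/
  | clearCarry : Prog
  /-- if `x ≤ y` then … else … -/
  | ifLe (x y : ℕ) (P Q : Prog) : Prog
  /-- if the carry is set then … else … -/
  | ifCarry (P Q : Prog) : Prog
  /-- if `D[…] = 0` then … else … -/
  | ifDigitZero (D : Cell) (P Q : Prog) : Prog
  /-- for `x = 0, 1, …, y - 1` do …, where `y` is read once, on entry -/
  | loop (x y : ℕ) (P : Prog) : Prog

/-- Memory contents. -/
structure State where
  /-- the counters -/
  counter : ℕ → ℕ
  /-- the arrays of counters: array number, subscripts -/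
  table : ℕ → List ℕ → ℕ
  /-- the arrays of digits: array number, subscripts -/
  digit : ℕ → List ℕ → ℕ
  /-- the carry flag -/
  carry : Bool

/-- The subscripts of a cell. -/
def State.address (s : State) (c : Cell) : List ℕ := c.subscripts.map s.counter

/-- Write a counter. -/
def State.setCounter (s : State) (x v : ℕ) : State :=
  { s with counter := Function.update s.counter x v }

/-- Write a cell of an array of counters. -/
def State.setTable (s : State) (c : Cell) (v : ℕ) : State :=
  { s with
    table := Function.update s.table c.array
      (Function.update (s.table c.array) (s.address c) v) }

/-- Read a digit. -/
def State.getDigit (s : State) (c : Cell) : ℕ := s.digit c.array (s.address c)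

/-- Write a digit. -/
def State.setDigit (s : State) (c : Cell) (v : ℕ) : State :=
  { s with
    digit := Function.update s.digit c.array
      (Function.update (s.digit c.array) (s.address c) v) }

/-- Run a program in base `q`; the result is the final memory together with the number of steps.
Every instruction, every test and every pass through a loop is a step, whether it acts on
digits or on counters. -/
def Prog.run (q : ℕ) : Prog → State → State × ℕ
  | .skip, s => (s, 1)
  | .seq P Q, s =>
      let r := P.run q s
      let r' := Q.run q r.1
      (r'.1, r.2 + r'.2)
  | .zero x, s => (s.setCounter x 0, 1)
  | .copy x y, s => (s.setCounter x (s.counter y), 1)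
  | .succ x, s => (s.setCounter x (s.counter x + 1), 1)
  | .sub x y z, s => (s.setCounter x (s.counter y - s.counter z), 1)
  | .load x T, s => (s.setCounter x (s.table T.array (s.address T)), 1)
  | .store T x, s => (s.setTable T (s.counter x), 1)
  | .digitZero D, s => (s.setDigit D 0, 1)
  | .digitOne D, s => (s.setDigit D 1, 1)
  | .digitCopy D D', s => (s.setDigit D (s.getDigit D'), 1)
  | .digitAdd D D' D'', s =>
      let t := s.getDigit D' + s.getDigit D'' + s.carry.toNat
      ({ s.setDigit D (t % q) with carry := decide (q ≤ t) }, 1)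
  | .clearCarry, s => ({ s with carry := false }, 1)
  | .ifLe x y P Q, s =>
      let r := if s.counter x ≤ s.counter y then P.run q s else Q.run q s
      (r.1, r.2 + 1)
  | .ifCarry P Q, s =>
      let r := if s.carry = true then P.run q s else Q.run q s
      (r.1, r.2 + 1)
  | .ifDigitZero D P Q, s =>
      let r := if s.getDigit D = 0 then P.run q s else Q.run q s
      (r.1, r.2 + 1)
  | .loop x y P, s =>
      (List.range (s.counter y)).foldl
        (fun acc i =>
          let r := P.run q (acc.1.setCounter x i)
          (r.1, acc.2 + r.2 + 1))
        (s, 1)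

/-- A list as a one-dimensional array with subscripts `0, 1, …`, and `0` elsewhere. -/
def listArray (l : List ℕ) : List ℕ → ℕ
  | [i] => l.getD i 0
  | _ => 0

/-- The input for `X`, given by its Ferrers tableaux form: counters `0` and `1` hold `k` and `n`,
counter array `0` holds the column sizes `F_1, …, F_{n-k}` of the Ferrers diagram, and digit
array `0` holds the digits of the entries vector `x_1, x_2, …`. Everything else is `0`. -/
noncomputable def inputState {F : Type*} [Field F] {n k q : ℕ} (e : F ≃ Fin q) (X : Gr F n k) :
    State where
  counter := fun x => if x = 0 then k else if x = 1 then n else 0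
  table := fun a => if a = 0 then listArray (diagram X) else fun _ => 0
  digit := fun a =>
    if a = 0 then listArray ((entries X).map fun b => (e b : ℕ)) else fun _ => 0
  carry := false

/-- Digit array `1` holds the base-`q` representation of `N`: the `t`-th cell has the digit
of `q ^ t`. -/
def State.HasOutput (s : State) (q N : ℕ) : Prop :=
  ∀ t : ℕ, s.digit 1 [t] = N / q ^ t % q

end FerrersCoding

/-! The reduced row echelon form identifies a subspace with a pair: the word of pivot and free
columns, which determines the Ferrers diagram, and an arbitrary vector of field elements that fills
the dots. A diagram of size m therefore carries q^m subspaces, and the index is a sum over words: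
q^m for every larger diagram, q^|F_X| for every earlier diagram of the same size, and {x} for the
diagram of X itself (`Ind_eq_sum_words`). The words whose diagram has size m are counted by
partitions in a box (`wordCount_sum_eq`). An earlier diagram of the same size is sorted by the first
column j in which it deviates from F_X and by its number a of dots there, F_j < a ≤ F_{j-1}; its
remaining columns form an arbitrary diagram in an a × (n-k-j) box (`wordCount_DiagramLT`).

For the running time put M = k(n-k). The program tabulates p(a, η, m) for all a ≤ k, η ≤ n-k, m ≤ M
with one long addition per entry. These are O(M²) entries, so the exponent 5/2 demands that each has
only O(√M) digits. This is the analytic core: with s = ⌈√M⌉, evaluating the generating function of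
partitions at s/(s+1) bounds every entry by (1+1/s)^m times a binomial coefficient
(`boxCount_mul_pow_le`), which is less than 2^(5s) (`boxCount_lt`). Afterwards O(M) entries are
added to a number with 2M+2 digits, wide enough by `Ind_lt`; powers of q are mere shifts of
subscripts, so this costs O(M²).

Correctness and cost are proved together by Hoare triples with a step bound (`Achieves`); what a
program leaves untouched is read off from its text (`Frame`). -/

/-! ### Counting partitions in a box -/

namespace FerrersCoding

/-- The number of antitone sequences of length `η` with entries at most `a` and sum `m`,
by recursion on the first entry. -/
def boxCount : ℕ → ℕ → ℕ → ℕ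
  | 0, _, m => if m = 0 then 1 else 0
  | _ + 1, 0, m => if m = 0 then 1 else 0
  | a + 1, η + 1, m =>
      boxCount a (η + 1) m + if a + 1 ≤ m then boxCount (a + 1) η (m - (a + 1)) else 0

theorem boxCount_zero_left (η m : ℕ) : boxCount 0 η m = if m = 0 then 1 else 0 := by
  simp [boxCount]

theorem boxCount_zero_right (a m : ℕ) : boxCount a 0 m = if m = 0 then 1 else 0 := by
  cases a <;> simp [boxCount]

theorem boxCount_succ (a η m : ℕ) :
    boxCount (a + 1) (η + 1) m =
      boxCount a (η + 1) m + if a + 1 ≤ m then boxCount (a + 1) η (m - (a + 1)) else 0 := by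
  rw [boxCount]

theorem boxCount_one_left (η m : ℕ) : boxCount 1 η m = if m ≤ η then 1 else 0 := by
  induction η generalizing m with
  | zero => simp [boxCount_zero_right]
  | succ η ih =>
    rw [boxCount_succ, boxCount_zero_left, ih]
    split_ifs <;> omega

theorem boxCount_one_right (a m : ℕ) : boxCount a 1 m = if m ≤ a then 1 else 0 := by
  induction a generalizing m with
  | zero => simp [boxCount_zero_left]
  | succ a ih =>
    rw [boxCount_succ, boxCount_zero_right, ih]
    split_ifs <;> omega

/-- The recursion on whether all entries are positive. -/
theorem boxCount_succ' (a η m : ℕ) :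
    boxCount (a + 1) (η + 1) m =
      boxCount (a + 1) η m + if η + 1 ≤ m then boxCount a (η + 1) (m - (η + 1)) else 0 := by
  induction h : a + η using Nat.strong_induction_on generalizing a η m with
  | _ N ih =>
    rcases a with _ | a
    · simp only [zero_add, boxCount_one_left, boxCount_zero_left]
      split_ifs <;> omega
    rcases η with _ | η
    · simp only [zero_add, boxCount_one_right, boxCount_zero_right]
      split_ifs <;> omega
    rw [boxCount_succ, ih (a + (η + 1)) (by omega) a (η + 1) m rfl,
      boxCount_succ (a + 1) η m]
    -- Both sides are expanded by both recursions. The mixed terms of `h1` and `h2` agree because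
    -- each deletes a full hook, of (a + 1 + 1) + (η + 1) dots.
    have h1 : (if a + 1 + 1 ≤ m then boxCount (a + 1 + 1) (η + 1) (m - (a + 1 + 1)) else 0) =
        (if a + 1 + 1 ≤ m then boxCount (a + 1 + 1) η (m - (a + 1 + 1)) else 0) +
        (if a + 1 + 1 + (η + 1) ≤ m then boxCount (a + 1) (η + 1) (m - (a + 1 + 1) - (η + 1))
          else 0) := by
      by_cases hm : a + 1 + 1 ≤ m
      · rw [if_pos hm, if_pos hm, ih (a + 1 + η) (by omega) (a + 1) η _ rfl]
        congr 1
        exact if_congr (by omega) rfl rfl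
      · rw [if_neg hm, if_neg hm, if_neg (by omega)]
    have h2 : (if η + 1 + 1 ≤ m then boxCount (a + 1) (η + 1 + 1) (m - (η + 1 + 1)) else 0) =
        (if η + 1 + 1 ≤ m then boxCount a (η + 1 + 1) (m - (η + 1 + 1)) else 0) +
        (if a + 1 + 1 + (η + 1) ≤ m then boxCount (a + 1) (η + 1) (m - (a + 1 + 1) - (η + 1))
          else 0) := by
      by_cases hm : η + 1 + 1 ≤ m
      · rw [if_pos hm, if_pos hm, boxCount_succ]
        congr 1
        rw [show m - (η + 1 + 1) - (a + 1) = m - (a + 1 + 1) - (η + 1) by omega]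
        exact if_congr (by omega) rfl rfl
      · rw [if_neg hm, if_neg hm, if_neg (by omega)]
    rw [h1, h2]
    ring

/-- Swapping the sides of the box interchanges the two recursions; this is conjugation of partitions
without a bijection. -/
theorem boxCount_comm (a η m : ℕ) : boxCount a η m = boxCount η a m := by
  induction h : a + η using Nat.strong_induction_on generalizing a η m with
  | _ N ih =>
    rcases a with _ | a
    · rw [boxCount_zero_left, boxCount_zero_right]
    rcases η with _ | η
    · rw [boxCount_zero_left, boxCount_zero_right]
    rw [boxCount_succ, boxCount_succ' η a, ih (a + (η + 1)) (by omega) a (η + 1) m rfl,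
      ih (a + 1 + η) (by omega) (a + 1) η _ rfl]

/-- The table of the numbers `boxCount` with all indices shifted by one and a boundary that
makes its recursion free of case distinctions. -/
def boxCell : ℕ → ℕ → ℕ → ℕ
  | 0, η, m => if η = 1 ∧ m = 1 then 1 else 0
  | _ + 1, 0, _ => 0
  | _ + 1, _ + 1, 0 => 0
  | a + 1, η + 1, m + 1 => boxCount a η m

theorem boxCell_succ_succ_succ (a η m : ℕ) :
    boxCell (a + 1) (η + 1) (m + 1) = boxCount a η m := by
  rw [boxCell]

theorem boxCell_zero_middle (a m : ℕ) : boxCell a 0 m = 0 := by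
  cases a <;> simp [boxCell]

theorem boxCell_zero_right (a η : ℕ) : boxCell a η 0 = 0 := by
  cases a <;> cases η <;> simp [boxCell]

/-- Truncated subtraction makes the case distinction: m + 1 - a is 0 exactly when a column of a dots
does not fit, and cells with last index 0 vanish. The single 1 at (0, 1, 1) generates the layer of
the empty box. This is the recursion that the program runs. -/
theorem boxCell_succ (a η m : ℕ) :
    boxCell (a + 1) (η + 1) (m + 1) =
      boxCell a (η + 1) (m + 1) + boxCell (a + 1) η (m + 1 - a) := by
  rcases a with _ | a
  · rcases η with _ | η
    · simp [boxCell, boxCount_zero_left]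
    · simp [boxCell, boxCount_zero_left]
  · rcases η with _ | η
    · simp [boxCell, boxCount_zero_right]
    · rw [boxCell, boxCell, boxCount_succ]
      congr 1
      by_cases h : a + 1 ≤ m
      · rw [if_pos h, show m + 1 - (a + 1) = m - (a + 1) + 1 by omega, boxCell]
      · rw [if_neg h, show m + 1 - (a + 1) = 0 by omega, boxCell]

/-! ### The size of the numbers -/

/-- With x = s/(s+1), the coefficient times x^m is at most ∏_{i ≤ a} 1/(1 - x^i), and 1/(1 - x^i) ≤
(s+i)/i by Bernoulli; the product of the right sides is the binomial coefficient. The bound does not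
depend on η. The induction below avoids infinite series and denominators. -/
theorem boxCount_mul_pow_le (s a η m : ℕ) :
    boxCount a η m * s ^ m ≤ (s + 1) ^ m * (s + a).choose a := by
  induction h : a + η using Nat.strong_induction_on generalizing a η m with
  | _ N ih =>
    rcases a with _ | a
    · rw [boxCount_zero_left]
      split_ifs with hm
      · simp [hm]
      · simp
    rcases η with _ | η
    · rw [boxCount_zero_right]
      split_ifs with hm
      · subst hm
        simpa using Nat.succ_le_of_lt (Nat.choose_pos (by omega))
      · simp
    have h1 := ih (a + (η + 1)) (by omega) a (η + 1) m rfl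
    rw [boxCount_succ, add_mul]
    have hc : (s + (a + 1)).choose (a + 1) * (a + 1) = (s + a).choose a * (s + (a + 1)) := by
      have := Nat.add_one_mul_choose_eq (s + a) a
      rw [← add_assoc]
      linarith
    split_ifs with hm
    · have h2 := ih (a + 1 + η) (by omega) (a + 1) η (m - (a + 1)) rfl
      obtain ⟨m, rfl⟩ := Nat.exists_eq_add_of_le hm
      rw [Nat.add_sub_cancel_left] at *
      -- Bernoulli's inequality for (1 + 1/s)^(a+1), multiplied by s^(a+1).
      have hb : s ^ a * (s + (a + 1)) ≤ (s + 1) ^ (a + 1) := by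
        clear * -
        induction a with
        | zero => simp
        | succ a ih =>
          calc s ^ (a + 1) * (s + (a + 1 + 1))
              ≤ s ^ a * (s + (a + 1)) * (s + 1) := by
                rw [pow_succ, mul_assoc, mul_assoc]
                exact Nat.mul_le_mul_left _ (by nlinarith)
            _ ≤ _ := by rw [pow_succ (s + 1)]; exact Nat.mul_le_mul_right _ ih
      -- What remains of the induction step without the factor (s + 1)^m. Multiplying by s + a + 1
      -- expresses both binomial coefficients through one, by `hc`.
      have key : (s + a).choose a * (s + 1) ^ (a + 1) +
          s ^ (a + 1) * (s + (a + 1)).choose (a + 1) ≤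
          (s + 1) ^ (a + 1) * (s + (a + 1)).choose (a + 1) := by
        refine Nat.le_of_mul_le_mul_right ?_ (show 0 < s + (a + 1) by omega)
        calc ((s + a).choose a * (s + 1) ^ (a + 1) +
              s ^ (a + 1) * (s + (a + 1)).choose (a + 1)) * (s + (a + 1))
            = (s + (a + 1)).choose (a + 1) * ((a + 1) * (s + 1) ^ (a + 1) +
                s * (s ^ a * (s + (a + 1)))) := by
              rw [add_mul, mul_right_comm, ← hc]; ring
          _ ≤ (s + (a + 1)).choose (a + 1) * ((a + 1) * (s + 1) ^ (a + 1) +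
                s * (s + 1) ^ (a + 1)) := by gcongr
          _ = _ := by ring
      calc _ ≤ (s + 1) ^ (a + 1 + m) * (s + a).choose a +
            s ^ (a + 1) * ((s + 1) ^ m * (s + (a + 1)).choose (a + 1)) := by
            refine add_le_add h1 ?_
            rw [pow_add, ← mul_assoc, mul_comm _ (s ^ (a + 1)), mul_assoc]
            exact Nat.mul_le_mul_left _ h2
        _ = (s + 1) ^ m * ((s + a).choose a * (s + 1) ^ (a + 1) +
          s ^ (a + 1) * (s + (a + 1)).choose (a + 1)) := by ring
        _ ≤ (s + 1) ^ m * ((s + 1) ^ (a + 1) * (s + (a + 1)).choose (a + 1)) := by gcongr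
        _ = _ := by ring
    · rw [zero_mul, add_zero]
      refine h1.trans (Nat.mul_le_mul_left _ ?_)
      rw [← add_assoc, Nat.choose_succ_succ]
      omega

/-- (1 + 1/s)^m ≤ exp(m/s) ≤ e^s, and e < 4. -/
theorem succ_pow_le_four_pow_mul (s m : ℕ) (hm : m ≤ s ^ 2) :
    (s + 1) ^ m ≤ 4 ^ s * s ^ m := by
  rcases Nat.eq_zero_or_pos s with rfl | hs
  · simp at hm
    simp [hm]
  have hs' : (0 : ℝ) < s := by exact_mod_cast hs
  have h1 : ((s : ℝ) + 1) ≤ Real.exp (1 / s) * s := by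
    have := Real.add_one_le_exp (1 / (s : ℝ))
    calc (s : ℝ) + 1 = (1 / s + 1) * s := by field_simp; ring
      _ ≤ _ := by gcongr
  have h2 : ((s : ℝ) + 1) ^ m ≤ 4 ^ s * s ^ m := by
    calc ((s : ℝ) + 1) ^ m ≤ (Real.exp (1 / s) * s) ^ m := by gcongr
      _ = Real.exp (m / s) * s ^ m := by
        rw [mul_pow, ← Real.exp_nat_mul]; congr 2; ring
      _ ≤ Real.exp (s * 1) * s ^ m := by
        gcongr
        rw [div_le_iff₀ hs']
        have : (m : ℝ) ≤ s ^ 2 := by exact_mod_cast hm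
        linarith
      _ ≤ _ := by
        rw [Real.exp_nat_mul]
        gcongr
        exact Real.exp_one_lt_d9.le.trans (by norm_num)
  exact_mod_cast h2

/-- By symmetry a is the smaller side, so a ≤ s and the binomial coefficient is at most 4^s. The
power contributes another 4^s, and 16^s < 32^s. In base q ≥ 2 this makes 5s digits suffice. -/
theorem boxCount_lt (s a η m : ℕ) (hs : 0 < s) (hm : m ≤ s ^ 2) (ha : a * η ≤ s ^ 2) :
    boxCount a η m < 2 ^ (5 * s) := by
  wlog h : a ≤ η generalizing a η
  · rw [boxCount_comm]
    exact this η a (by rwa [mul_comm]) (by omega)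
  have has : a ≤ s := by
    by_contra hcon
    have : s ^ 2 < a * η := by nlinarith
    omega
  have h1 := boxCount_mul_pow_le s a η m
  have h2 : (s + a).choose a ≤ 4 ^ s := by
    calc (s + a).choose a ≤ 2 ^ (s + a) := Nat.choose_le_two_pow _ _
      _ ≤ 2 ^ (2 * s) := Nat.pow_le_pow_right (by norm_num) (by omega)
      _ = 4 ^ s := by rw [pow_mul]; norm_num
  have h3 : boxCount a η m * s ^ m ≤ 16 ^ s * s ^ m := by
    calc _ ≤ _ := h1
      _ ≤ (4 ^ s * s ^ m) * 4 ^ s := Nat.mul_le_mul (succ_pow_le_four_pow_mul s m hm) h2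
      _ = (4 * 4) ^ s * s ^ m := by rw [mul_pow]; ring
  have h4 := Nat.le_of_mul_le_mul_right h3 (by positivity)
  calc _ ≤ _ := h4
    _ < 32 ^ s := Nat.pow_lt_pow_left (by norm_num) (by omega)
    _ = _ := by rw [pow_mul]; norm_num

/-! ### Partitions as multisets -/

/-- The partitions of `m` in an `a × η` box, as multisets. -/
def boxMultisets (a η m : ℕ) : Finset (Multiset ℕ) :=
  (Finset.univ.filter fun π : Nat.Partition m =>
    π.parts.card ≤ a ∧ ∀ b ∈ π.parts, b ≤ η).image Nat.Partition.parts

theorem mem_boxMultisets {a η m : ℕ} {s : Multiset ℕ} :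
    s ∈ boxMultisets a η m ↔
      (∀ b ∈ s, 0 < b) ∧ s.sum = m ∧ s.card ≤ a ∧ ∀ b ∈ s, b ≤ η := by
  simp only [boxMultisets, Finset.mem_image, Finset.mem_filter, Finset.mem_univ, true_and]
  constructor
  · rintro ⟨π, h, rfl⟩
    exact ⟨fun b hb => π.parts_pos hb, π.parts_sum, h⟩
  · rintro ⟨h1, h2, h3⟩
    exact ⟨⟨s, fun hb => h1 _ hb, h2⟩, h3, rfl⟩

theorem card_boxMultisets (a η m : ℕ) : (boxMultisets a η m).card = boxPartitions a η m := by
  rw [boxPartitions, if_pos (by positivity), boxMultisets, Finset.card_image_of_injective]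
  · rfl
  · intro π π' h
    exact Nat.Partition.ext h

/-- Either no part equals η + 1, or removing one such part leaves a partition with one part fewer;
this is the recursion `boxCount_succ'`. -/
theorem card_boxMultisets_eq (a η m : ℕ) : (boxMultisets a η m).card = boxCount a η m := by
  have hz : ∀ a η m : ℕ, (a = 0 ∨ η = 0) →
      (boxMultisets a η m).card = if m = 0 then 1 else 0 := by
    intro a η m h
    have h0 : ∀ s, s ∈ boxMultisets a η m ↔ s = 0 ∧ m = 0 := by
      intro s
      rw [mem_boxMultisets]
      constructor
      · rintro ⟨h1, h2, h3, h4⟩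
        have : s = 0 := by
          rcases h with rfl | rfl
          · exact Multiset.card_eq_zero.1 (by omega)
          · refine Multiset.eq_zero_of_forall_notMem fun b hb => ?_
            have := h1 b hb
            have := h4 b hb
            omega
        subst this
        exact ⟨rfl, by simpa using h2.symm⟩
      · rintro ⟨rfl, rfl⟩
        simp
    split_ifs with hm
    · rw [Finset.card_eq_one]
      exact ⟨0, by ext s; rw [h0]; simp [hm]⟩
    · rw [Finset.card_eq_zero]
      ext s
      simp [h0, hm]
  induction h : a + η using Nat.strong_induction_on generalizing a η m with
  | _ N ih =>
    rcases a with _ | a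
    · rw [hz _ _ _ (Or.inl rfl), boxCount_zero_left]
    rcases η with _ | η
    · rw [hz _ _ _ (Or.inr rfl), boxCount_zero_right]
    have hsplit : boxMultisets (a + 1) (η + 1) m = boxMultisets (a + 1) η m ∪
        if η + 1 ≤ m then (boxMultisets a (η + 1) (m - (η + 1))).image ((η + 1) ::ₘ ·)
        else ∅ := by
      ext s
      by_cases hs : η + 1 ∈ s
      · obtain ⟨t, rfl⟩ := Multiset.exists_cons_of_mem hs
        have h1 : (η + 1) ::ₘ t ∉ boxMultisets (a + 1) η m := by
          rw [mem_boxMultisets]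
          rintro ⟨-, -, -, h4⟩
          have := h4 (η + 1) (by simp)
          omega
        split_ifs with hm
        · simp only [Finset.mem_union, h1, false_or, Finset.mem_image, Multiset.cons_inj_right,
            exists_eq_right]
          simp only [mem_boxMultisets, Multiset.mem_cons, forall_eq_or_imp, Multiset.sum_cons,
            Multiset.card_cons]
          constructor
          · rintro ⟨⟨h1, h2⟩, h3, h4, h5, h6⟩
            exact ⟨h2, by omega, by omega, h6⟩
          · rintro ⟨h2, h3, h4, h6⟩
            exact ⟨⟨by omega, h2⟩, by omega, by omega, by omega, h6⟩
        · simp only [Finset.union_empty, h1, iff_false]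
          rw [mem_boxMultisets]
          rintro ⟨-, h2, -⟩
          rw [Multiset.sum_cons] at h2
          omega
      · have h1 : s ∉ (if η + 1 ≤ m then (boxMultisets a (η + 1) (m - (η + 1))).image
            ((η + 1) ::ₘ ·) else ∅) := by
          split_ifs with hm
          · simp only [Finset.mem_image, not_exists, not_and]
            rintro t - rfl
            exact hs (by simp)
          · simp
        simp only [Finset.mem_union, h1, or_false, mem_boxMultisets]
        refine and_congr_right fun _ => and_congr_right fun _ => and_congr_right fun _ => ?_
        refine forall₂_congr fun b hb => ?_
        have : b ≠ η + 1 := fun h => hs (h ▸ hb)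
        omega
    have hdisj : Disjoint (boxMultisets (a + 1) η m)
        (if η + 1 ≤ m then (boxMultisets a (η + 1) (m - (η + 1))).image ((η + 1) ::ₘ ·)
          else ∅) := by
      rw [Finset.disjoint_left]
      intro s hs
      split_ifs
      · simp only [Finset.mem_image, not_exists, not_and]
        rintro t - rfl
        have := (mem_boxMultisets.1 hs).2.2.2 (η + 1) (by simp)
        omega
      · simp
    rw [hsplit, Finset.card_union_of_disjoint hdisj, boxCount_succ',
      ih (a + 1 + η) (by omega) (a + 1) η m rfl]
    congr 1
    split_ifs with hm
    · rw [Finset.card_image_of_injective _ (fun s t h => by simpa using h),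
        ih (a + (η + 1)) (by omega) a (η + 1) _ rfl]
    · simp

theorem boxPartitions_eq_boxCount (a η m : ℕ) : boxPartitions a η m = boxCount a η m := by
  rw [← card_boxMultisets, card_boxMultisets_eq]

/-- The vanishing of p at negative integers becomes the vanishing of `boxCell` at last index 0, so
the machine needs no signed numbers. -/
theorem boxPartitions_sub_eq_boxCell (a η : ℕ) (m c : ℕ) :
    boxPartitions a η ((m : ℤ) - c) = boxCell (a + 1) (η + 1) (m + 1 - c) := by
  by_cases h : c ≤ m
  · rw [← Nat.cast_sub h, boxPartitions_eq_boxCount, show m + 1 - c = m - c + 1 by omega,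
      boxCell]
  · rw [boxPartitions, if_neg (by omega), show m + 1 - c = 0 by omega, boxCell]

end FerrersCoding

/-! ### Words of pivot and free columns -/

namespace FerrersCoding

/-- The Ferrers diagram of a word that lists the columns of a matrix from right to left, with
`true` for the columns that contain leading coefficients. -/
def wordDiagram : List Bool → List ℕ
  | [] => []
  | true :: w => wordDiagram w
  | false :: w => w.count true :: wordDiagram w

theorem length_wordDiagram (w : List Bool) : (wordDiagram w).length = w.count false := by
  induction w with
  | nil => rfl
  | cons b w ih => cases b <;> simp [wordDiagram, ih]

theorem le_count_of_mem_wordDiagram {w : List Bool} {c : ℕ} (h : c ∈ wordDiagram w) :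
    c ≤ w.count true := by
  induction w with
  | nil => simp [wordDiagram] at h
  | cons b w ih =>
    cases b
    · rw [wordDiagram, List.mem_cons] at h
      rcases h with rfl | h
      · simp
      · simpa using ih h
    · rw [wordDiagram] at h
      have := ih h
      simp
      omega

theorem wordDiagram_sum_le (w : List Bool) :
    (wordDiagram w).sum ≤ w.count true * w.count false := by
  have := List.sum_le_card_nsmul (wordDiagram w) _ fun c hc => le_count_of_mem_wordDiagram hc
  rwa [length_wordDiagram, smul_eq_mul, mul_comm] at this

/-- With the number of pivots known, the first letter is visible: a leading free column has all the
dots, whereas after a leading pivot every column has fewer. Without `ht`, final pivots would leave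
no trace. -/
theorem wordDiagram_injective {v w : List Bool} (ht : v.count true = w.count true)
    (h : wordDiagram v = wordDiagram w) : v = w := by
  induction v generalizing w with
  | nil =>
    rcases w with _ | ⟨b, w⟩
    · rfl
    · cases b
      · simp [wordDiagram] at h
      · simp at ht
  | cons b v ih =>
    have key : ∀ {v w : List Bool}, (true :: v).count true = (false :: w).count true →
        wordDiagram (true :: v) = wordDiagram (false :: w) → False := by
      intro v w ht h
      simp only [wordDiagram] at h
      have hm : w.count true ∈ wordDiagram v := by rw [h]; simp
      have := le_count_of_mem_wordDiagram hm
      simp at ht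
      omega
    rcases w with _ | ⟨c, w⟩
    · cases b
      · simp [wordDiagram] at h
      · simp at ht
    · cases b <;> cases c
      · simp only [wordDiagram, List.cons.injEq] at h
        rw [ih (by simpa using ht) h.2]
      · exact (key ht.symm h.symm).elim
      · exact (key ht h).elim
      · rw [ih (w := w) (by simpa using ht) h]

/-! ### Counting words by the size of their diagrams -/

/-- The words with `a` letters `true` and `b` letters `false`. -/
def words : ℕ → ℕ → Finset (List Bool)
  | 0, 0 => {[]}
  | a + 1, 0 => (words a 0).image (List.cons true)
  | 0, b + 1 => (words 0 b).image (List.cons false)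
  | a + 1, b + 1 =>
      (words a (b + 1)).image (List.cons true) ∪ (words (a + 1) b).image (List.cons false)

theorem mem_words {a b : ℕ} {w : List Bool} :
    w ∈ words a b ↔ w.count true = a ∧ w.count false = b := by
  induction w generalizing a b with
  | nil => cases a <;> cases b <;> simp [words]
  | cons c w ih => cases c <;> cases a <;> cases b <;> simp [words, ih]

theorem card_words_le (a b : ℕ) : (words a b).card ≤ 2 ^ (a + b) := by
  induction h : a + b using Nat.strong_induction_on generalizing a b with
  | _ N ih =>
    rcases a with _ | a <;> rcases b with _ | b
    · simp [words, Nat.one_le_two_pow]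
    · have := ih (0 + b) (by omega) 0 b rfl
      rw [words]
      refine Finset.card_image_le.trans (this.trans ?_)
      exact Nat.pow_le_pow_right (by norm_num) (by omega)
    · have := ih (a + 0) (by omega) a 0 rfl
      rw [words]
      refine Finset.card_image_le.trans (this.trans ?_)
      exact Nat.pow_le_pow_right (by norm_num) (by omega)
    · have h1 := ih (a + (b + 1)) (by omega) a (b + 1) rfl
      have h2 := ih (a + 1 + b) (by omega) (a + 1) b rfl
      rw [words]
      refine (Finset.card_union_le _ _).trans ((add_le_add Finset.card_image_le
        Finset.card_image_le).trans ((add_le_add h1 h2).trans ?_))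
      rw [← h, show a + 1 + (b + 1) = a + (b + 1) + 1 by ring, pow_succ,
        show a + 1 + b = a + (b + 1) by ring]
      omega

open Classical in
/-- The number of words with a given property. -/
noncomputable def wordCount (a b : ℕ) (p : List Bool → Prop) : ℕ := ((words a b).filter p).card

theorem wordCount_eq_card (a b : ℕ) (p : List Bool → Prop) [DecidablePred p] :
    wordCount a b p = ((words a b).filter p).card := by
  rw [wordCount]
  congr

theorem wordCount_congr {a b : ℕ} {p p' : List Bool → Prop} (h : ∀ w ∈ words a b, p w ↔ p' w) :
    wordCount a b p = wordCount a b p' := by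
  classical
  rw [wordCount, wordCount, Finset.filter_congr h]

theorem wordCount_false {a b : ℕ} {p : List Bool → Prop} (h : ∀ w ∈ words a b, ¬ p w) :
    wordCount a b p = 0 := by
  classical
  rw [wordCount, Finset.filter_false_of_mem h, Finset.card_empty]

theorem wordCount_zero_zero (p : List Bool → Prop) [Decidable (p [])] :
    wordCount 0 0 p = if p [] then 1 else 0 := by
  rw [wordCount, words, Finset.filter_singleton]
  split_ifs <;> simp

theorem card_filter_image_cons (s : Finset (List Bool)) (b : Bool) (p : List Bool → Prop)
    [DecidablePred p] :
    ((s.image (List.cons b)).filter p).card = (s.filter fun w => p (b :: w)).card := by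
  rw [Finset.filter_image, Finset.card_image_of_injective _ List.cons_injective]

theorem wordCount_succ_zero (a : ℕ) (p : List Bool → Prop) :
    wordCount (a + 1) 0 p = wordCount a 0 fun w => p (true :: w) := by
  rw [wordCount, words, card_filter_image_cons, wordCount]

theorem wordCount_zero_succ (b : ℕ) (p : List Bool → Prop) :
    wordCount 0 (b + 1) p = wordCount 0 b fun w => p (false :: w) := by
  rw [wordCount, words, card_filter_image_cons, wordCount]

theorem wordCount_succ_succ (a b : ℕ) (p : List Bool → Prop) :
    wordCount (a + 1) (b + 1) p =
      (wordCount a (b + 1) fun w => p (true :: w)) +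
        wordCount (a + 1) b fun w => p (false :: w) := by
  classical
  rw [wordCount, words, Finset.filter_union, Finset.card_union_of_disjoint,
    card_filter_image_cons, card_filter_image_cons, wordCount, wordCount]
  rw [Finset.disjoint_left]
  intro w h1 h2
  simp only [Finset.mem_filter, Finset.mem_image] at h1 h2
  obtain ⟨⟨v, -, rfl⟩, -⟩ := h1
  obtain ⟨⟨v', -, h⟩, -⟩ := h2
  simp at h

/-- The number of words whose diagram has a given size. -/
theorem wordCount_sum_eq (a b m : ℕ) :
    (wordCount a b fun w => (wordDiagram w).sum = m) = boxCount a b m := by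
  induction h : a + b using Nat.strong_induction_on generalizing a b m with
  | _ N ih =>
    rcases a with _ | a <;> rcases b with _ | b
    · rw [wordCount_zero_zero, boxCount_zero_left]
      simp [wordDiagram, eq_comm]
    · have h1 := ih (0 + b) (by omega) 0 b m rfl
      rw [boxCount_zero_left] at h1 ⊢
      rw [wordCount_zero_succ, ← h1]
      refine wordCount_congr fun w hw => ?_
      rw [mem_words] at hw
      simp [wordDiagram, hw.1]
    · have h1 := ih (a + 0) (by omega) a 0 m rfl
      rw [boxCount_zero_right] at h1 ⊢
      rw [wordCount_succ_zero, ← h1]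
      rfl
    · have h1 := ih (a + (b + 1)) (by omega) a (b + 1) m rfl
      have h2 := ih (a + 1 + b) (by omega) (a + 1) b (m - (a + 1)) rfl
      rw [wordCount_succ_succ, boxCount_succ, ← h1]
      congr 1
      split_ifs with hm
      · rw [← h2]
        refine wordCount_congr fun w hw => ?_
        rw [mem_words] at hw
        simp only [wordDiagram, hw.1, List.sum_cons]
        omega
      · refine wordCount_false fun w hw => ?_
        rw [mem_words] at hw
        simp only [wordDiagram, hw.1, List.sum_cons]
        omega

/-! ### The rank of a diagram among those of the same size -/

theorem DiagramLT_cons {a b : ℕ} {D E : List ℕ} :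
    DiagramLT (a :: D) (b :: E) ↔ b < a ∨ a = b ∧ DiagramLT D E := by
  constructor
  · rintro ⟨i, h1, h2⟩
    rcases i with _ | i
    · left; simpa using h2
    · right
      refine ⟨by simpa using h1 0 (by omega), i, fun j hj => ?_, by simpa using h2⟩
      simpa using h1 (j + 1) (by omega)
  · rintro (h | ⟨rfl, i, h1, h2⟩)
    · exact ⟨0, by simp, by simpa using h⟩
    · refine ⟨i + 1, fun j hj => ?_, by simpa using h2⟩
      rcases j with _ | j
      · simp
      · simpa using h1 j (by omega)

theorem not_DiagramLT_nil : ¬ DiagramLT [] [] := by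
  rintro ⟨i, -, h⟩
  simp at h

/-- The number of diagrams of the same size that precede `D`, as a sum over the columns of `D`;
`c` is the number of dots in the column before `D`, and `r` the size of `D`. -/
def diagramRank : ℕ → ℕ → List ℕ → ℕ
  | _, _, [] => 0
  | c, r, b :: D =>
      ∑ i ∈ Finset.range (c - b), boxCell (b + 1 + i + 1) (D.length + 1) (r + 1 - (b + 1 + i)) +
        diagramRank b (r - b) D

theorem exists_wordDiagram_eq_cons {w : List Bool} {a b : ℕ} (h : w ∈ words a (b + 1)) :
    ∃ c D, wordDiagram w = c :: D ∧ c ≤ a ∧ D.length = b := by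
  rw [mem_words] at h
  rcases hD : wordDiagram w with _ | ⟨c, D⟩
  · have := length_wordDiagram w
    rw [hD, h.2] at this
    simp at this
  · refine ⟨c, D, rfl, ?_, ?_⟩
    · rw [← h.1]
      exact le_count_of_mem_wordDiagram (by rw [hD]; simp)
    · have := length_wordDiagram w
      rw [hD, h.2] at this
      simpa using this

/-- The number of words with a preceding diagram of the same size. -/
theorem wordCount_DiagramLT {a b : ℕ} {w : List Bool} (hw : w ∈ words a b) :
    (wordCount a b fun v => (wordDiagram v).sum = (wordDiagram w).sum ∧
      DiagramLT (wordDiagram v) (wordDiagram w)) =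
      diagramRank a (wordDiagram w).sum (wordDiagram w) := by
  induction w generalizing a b with
  | nil =>
    obtain ⟨rfl, rfl⟩ := mem_words.1 hw
    rw [wordDiagram, diagramRank]
    refine wordCount_false fun v hv => ?_
    simp only [List.count_nil, words, Finset.mem_singleton] at hv
    subst hv
    exact fun h => not_DiagramLT_nil h.2
  | cons c w ih =>
    cases c
    · rcases b with _ | b
      · simp [mem_words] at hw
      have hw' : w ∈ words a b := by simpa [mem_words] using hw
      have hc : w.count true = a := (mem_words.1 hw').1
      -- The first column of the given word is already as large as possible. A preceding word must
      -- agree there, so only the tails are compared and the first inner sum is empty.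
      have hF : (wordCount a b fun v =>
          (wordDiagram (false :: v)).sum = (wordDiagram (false :: w)).sum ∧
            DiagramLT (wordDiagram (false :: v)) (wordDiagram (false :: w))) =
          diagramRank a (wordDiagram (false :: w)).sum (wordDiagram (false :: w)) := by
        rw [wordDiagram, diagramRank, hc]
        simp only [Nat.sub_self, Finset.range_zero, Finset.sum_empty, zero_add, List.sum_cons,
          Nat.add_sub_cancel_left]
        rw [← ih hw']
        refine wordCount_congr fun v hv => ?_
        have hv' := (mem_words.1 hv).1
        simp [wordDiagram, DiagramLT_cons, hv']
      rcases a with _ | a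
      · rw [wordCount_zero_succ, hF]
      · rw [wordCount_succ_succ, hF, wordCount_false, zero_add]
        rintro v hv ⟨-, h⟩
        obtain ⟨c, D, hD, hc', -⟩ := exists_wordDiagram_eq_cons hv
        rw [wordDiagram, wordDiagram, hD, hc, DiagramLT_cons] at h
        omega
    · rcases a with _ | a
      · simp [mem_words] at hw
      have hw' : w ∈ words a b := by simpa [mem_words] using hw
      rcases b with _ | b
      · rw [wordCount_succ_zero]
        refine (ih hw').trans ?_
        have : wordDiagram w = [] := by
          rw [← List.length_eq_zero_iff, length_wordDiagram, (mem_words.1 hw').2]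
        rw [wordDiagram, this, diagramRank, diagramRank]
      · obtain ⟨c, D, hD, hc, hl⟩ := exists_wordDiagram_eq_cons hw'
        rw [wordCount_succ_succ]
        have h1 := ih hw'
        simp only [wordDiagram] at h1 ⊢
        -- Words that begin with a pivot are ranked with bound a instead of a + 1. The one
        -- additional summand counts the words that begin with a free column: these have a + 1 > c
        -- dots there, so all of the right size precede.
        rw [h1, hD, diagramRank, diagramRank, show a + 1 - c = a - c + 1 by omega,
          Finset.sum_range_succ, hl, show c + 1 + (a - c) = a + 1 by omega]
        have h2 : (wordCount (a + 1) b fun v =>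
            (v.count true :: wordDiagram v).sum = (c :: D).sum ∧
              DiagramLT (v.count true :: wordDiagram v) (c :: D)) =
            boxCell (a + 1 + 1) (b + 1) ((c :: D).sum + 1 - (a + 1)) := by
          by_cases hm : a + 1 ≤ (c :: D).sum
          · rw [show (c :: D).sum + 1 - (a + 1) = (c :: D).sum - (a + 1) + 1 by omega, boxCell,
              ← wordCount_sum_eq]
            refine wordCount_congr fun v hv => ?_
            have hv' := (mem_words.1 hv).1
            rw [DiagramLT_cons, hv', List.sum_cons]
            omega
          · rw [show (c :: D).sum + 1 - (a + 1) = 0 by omega, boxCell]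
            refine wordCount_false fun v hv => ?_
            have hv' := (mem_words.1 hv).1
            rw [hv', List.sum_cons]
            omega
        rw [h2]
        ring

/-- The rank of a diagram, as an explicit sum over its columns. -/
theorem diagramRank_eq_sum (c r : ℕ) (D : List ℕ) (hr : D.sum ≤ r) :
    diagramRank c r D = ∑ j ∈ Finset.range D.length,
      ∑ a ∈ Finset.Icc (D.getD j 0 + 1) (if j = 0 then c else D.getD (j - 1) 0),
        boxPartitions a (D.length - (j + 1))
          ((r : ℤ) - ∑ i ∈ Finset.range j, (D.getD i 0 : ℤ) - (a : ℤ)) := by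
  induction D generalizing c r with
  | nil => simp [diagramRank]
  | cons b D ih =>
    rw [diagramRank, List.length_cons, Finset.sum_range_succ', add_comm]
    rw [List.sum_cons] at hr
    congr 1
    · rw [ih b (r - b) (by omega)]
      refine Finset.sum_congr rfl fun j _ => ?_
      have h1 : (if j + 1 = 0 then c else (b :: D).getD (j + 1 - 1) 0) =
          if j = 0 then b else D.getD (j - 1) 0 := by
        rcases j with _ | j <;> simp
      rw [h1, List.getD_cons_succ]
      refine Finset.sum_congr rfl fun a _ => ?_
      rw [Finset.sum_range_succ', show D.length + 1 - (j + 1 + 1) = D.length - (j + 1) by omega]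
      congr 2
      simp only [List.getD_cons_succ, List.getD_cons_zero]
      push_cast [show b ≤ r by omega]
      ring
    · simp only [List.getD_cons_zero, Finset.range_zero, Finset.sum_empty, sub_zero, if_true]
      rw [← Finset.Ico_add_one_right_eq_Icc, Finset.sum_Ico_eq_sum_range,
        show c + 1 - (b + 1) = c - b by omega]
      refine Finset.sum_congr rfl fun i _ => ?_
      rw [boxPartitions_sub_eq_boxCell]
      simp

end FerrersCoding

/-! ### Reduced row echelon forms of subspaces -/

namespace FerrersCoding

variable {F : Type*} [Field F] {n k : ℕ}

/-- `A` is in reduced row echelon form, has no zero row, and its leading coefficients are in the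
columns `p i`. -/
structure HasPivots (p : Fin k → Fin n) (A : Matrix (Fin k) (Fin n) F) : Prop where
  strictMono : StrictMono p
  apply_pivot : ∀ i j, A i (p j) = if i = j then 1 else 0
  apply_eq_zero : ∀ i c, c < p i → A i c = 0

namespace HasPivots

variable {p p' : Fin k → Fin n} {A A' : Matrix (Fin k) (Fin n) F}

theorem isLeadingEntry_iff (h : HasPivots p A) {i : Fin k} {c : Fin n} :
    A.IsLeadingEntry i c ↔ p i = c := by
  have h1 : A.IsLeadingEntry i (p i) :=
    ⟨h.apply_eq_zero i, by rw [h.apply_pivot, if_pos rfl]; exact one_ne_zero⟩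
  constructor
  · exact fun h2 => h1.unique h2
  · rintro rfl
    exact h1

theorem isReducedRowEchelon (h : HasPivots p A) : A.IsReducedRowEchelon where
  isRowEchelon := by
    intro i₁ i₂ hlt j hj
    refine h.apply_eq_zero _ _ (lt_of_le_of_lt ?_ (h.strictMono hlt))
    by_contra! hcon
    have := hj _ hcon
    rw [h.apply_pivot, if_pos rfl] at this
    exact one_ne_zero this
  eq_one := by
    intro i c hc
    rw [← h.isLeadingEntry_iff.1 hc, h.apply_pivot, if_pos rfl]
  eq_zero := by
    intro i₁ i₂ c hlt hc
    rw [← h.isLeadingEntry_iff.1 hc, h.apply_pivot, if_neg hlt.ne]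

theorem sum_apply_pivot (h : HasPivots p A) (g : Fin k → F) (j : Fin k) :
    (∑ i, g i • A i) (p j) = g j := by
  simp [Finset.sum_apply, h.apply_pivot]

theorem linearIndependent (h : HasPivots p A) : LinearIndependent F fun i => A i := by
  rw [Fintype.linearIndependent_iff]
  intro g hg i
  rw [← h.sum_apply_pivot g i, hg, Pi.zero_apply]

theorem finrank_span (h : HasPivots p A) :
    Module.finrank F (Submodule.span F (Set.range fun i => A i)) = k := by
  rw [finrank_span_eq_card h.linearIndependent, Fintype.card_fin]

theorem eq_sum_of_mem_span (h : HasPivots p A) {v : Fin n → F}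
    (hv : v ∈ Submodule.span F (Set.range fun i => A i)) : v = ∑ i, v (p i) • A i := by
  obtain ⟨g, rfl⟩ := (Submodule.mem_span_range_iff_exists_fun F).1 hv
  simp only [h.sum_apply_pivot]

/-- Expand v in the rows with coefficients v (p i). At a column c that is no pivot, rows with pivot
left of c have coefficient 0 and rows with pivot right of c have entry 0. -/
theorem mem_range_of_leading (h : HasPivots p A) {v : Fin n → F} {c : Fin n}
    (hv : v ∈ Submodule.span F (Set.range fun i => A i)) (h0 : ∀ j < c, v j = 0)
    (hc : v c ≠ 0) : c ∈ Set.range p := by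
  by_contra hcon
  apply hc
  rw [h.eq_sum_of_mem_span hv, Finset.sum_apply]
  refine Finset.sum_eq_zero fun i _ => ?_
  rw [Pi.smul_apply, smul_eq_mul]
  rcases lt_trichotomy (p i) c with hi | hi | hi
  · rw [h0 _ hi, zero_mul]
  · exact (hcon ⟨i, hi⟩).elim
  · rw [h.apply_eq_zero i c hi, mul_zero]

theorem range_subset (h : HasPivots p A) (h' : HasPivots p' A')
    (hs : Submodule.span F (Set.range fun i => A i) =
      Submodule.span F (Set.range fun i => A' i)) : Set.range p ⊆ Set.range p' := by
  rintro _ ⟨i, rfl⟩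
  refine h'.mem_range_of_leading (v := A i) ?_ (h.apply_eq_zero i) ?_
  · rw [← hs]
    exact Submodule.subset_span ⟨i, rfl⟩
  · rw [h.apply_pivot, if_pos rfl]
    exact one_ne_zero

/-- The pivot columns are the leading positions of vectors of the row space, so they depend only on
that space. Expanding a row of A in the rows of A', with coefficients read off at the pivots, leaves
a single term. -/
theorem unique (h : HasPivots p A) (h' : HasPivots p' A')
    (hs : Submodule.span F (Set.range fun i => A i) =
      Submodule.span F (Set.range fun i => A' i)) : p = p' ∧ A = A' := by
  have hp : p = p' := (h.strictMono.range_inj h'.strictMono).1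
    ((h.range_subset h' hs).antisymm (h'.range_subset h hs.symm))
  refine ⟨hp, ?_⟩
  subst hp
  funext i
  have hi : A i ∈ Submodule.span F (Set.range fun i => A' i) := by
    rw [← hs]
    exact Submodule.subset_span ⟨i, rfl⟩
  rw [h'.eq_sum_of_mem_span hi]
  simp only [h.apply_pivot, ite_smul, one_smul, zero_smul]
  exact (Finset.sum_ite_eq _ _ _).trans (if_pos (Finset.mem_univ _))

end HasPivots

theorem exists_hasPivots_of_isReducedRowEchelon {A : Matrix (Fin k) (Fin n) F}
    (hA : A.IsReducedRowEchelon)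
    (hr : Module.finrank F (Submodule.span F (Set.range fun i => A i)) = k) :
    ∃ p, HasPivots p A := by
  have hli : LinearIndependent F fun i => A i := by
    rw [linearIndependent_iff_card_eq_finrank_span, Fintype.card_fin]
    exact hr.symm
  have hlead : ∀ i, ∃ c, A.IsLeadingEntry i c := fun i =>
    Matrix.row_ne_zero_iff_exists_isLeadingEntry.1 (hli.ne_zero i)
  choose p hp using hlead
  refine ⟨p, fun i j hij => ?_, fun i j => ?_, fun i => (hp i).1⟩
  · by_contra! hcon
    exact (hp j).2 (hA.isRowEchelon hij fun c hc => (hp i).1 c (hc.trans_le hcon))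
  · split_ifs with hij
    · subst hij
      exact hA.eq_one (hp i)
    · exact hA.eq_zero_of_ne_of_isLeadingEntry hij (hp j)

/-- Let S be the set of leading positions of vectors of X. Restriction to S is an isomorphism from X
to F^S, so |S| = k, and the preimages of the unit vectors are the rows sought. No elimination is
carried out. -/
theorem exists_hasPivots_span_eq (X : Gr F n k) :
    ∃ (p : Fin k → Fin n) (A : Matrix (Fin k) (Fin n) F), HasPivots p A ∧
      Submodule.span F (Set.range fun i => A i) = X.1 := by
  classical
  obtain ⟨X, hX⟩ := X
  let S : Finset (Fin n) := Finset.univ.filter fun c =>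
    ∃ v ∈ X, (∀ j < c, v j = 0) ∧ v c ≠ 0
  have hS : ∀ v ∈ X, v ≠ 0 → ∃ c ∈ S, (∀ j < c, v j = 0) ∧ v c ≠ 0 := by
    intro v hv hv0
    obtain ⟨c, hc, hmin⟩ :=
      wellFounded_lt.has_min {j | v j ≠ 0} (Function.ne_iff.mp hv0)
    have h0 : ∀ j < c, v j = 0 := fun j hj => by
      by_contra hcon
      exact hmin j hcon hj
    exact ⟨c, Finset.mem_filter.2 ⟨Finset.mem_univ _, v, hv, h0, hc⟩, h0, hc⟩
  let ρ : X →ₗ[F] (S → F) := (LinearMap.funLeft F F (Subtype.val : S → Fin n)).comp X.subtype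
  have hρ : ∀ (v : X) (c : S), ρ v c = v.1 c.1 := fun v c => rfl
  have hinj : Function.Injective ρ := by
    rw [← LinearMap.ker_eq_bot, LinearMap.ker_eq_bot']
    intro v hv
    by_contra hcon
    obtain ⟨c, hc, -, h⟩ := hS v.1 v.2 (fun h => hcon (Subtype.ext h))
    exact h (by rw [← hρ v ⟨c, hc⟩, hv, Pi.zero_apply])
  -- Induction from the right: a vector of X with leading position c restricts to a multiple of the
  -- unit vector at c plus unit vectors at larger positions, which are already reached.
  have hsingle : ∀ c : S, Pi.single c (1 : F) ∈ LinearMap.range ρ := by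
    intro c
    induction c using WellFoundedGT.induction with
    | ind c ih =>
      obtain ⟨u, hu, h0, hc⟩ := (Finset.mem_filter.1 c.2).2
      have h1 : ρ ⟨u, hu⟩ = u c • Pi.single c (1 : F) +
          ∑ c' ∈ Finset.univ.erase c, u c' • Pi.single c' (1 : F) := by
        rw [Finset.add_sum_erase _ (fun c' : S => u c' • Pi.single c' (1 : F))
          (Finset.mem_univ c)]
        ext c'
        rw [hρ, Finset.sum_apply]
        simp [Pi.single_apply]
      have h2 : Pi.single c (1 : F) = (u c)⁻¹ • (ρ ⟨u, hu⟩ -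
          ∑ c' ∈ Finset.univ.erase c, u c' • Pi.single c' (1 : F)) := by
        rw [h1, add_sub_cancel_right, smul_smul, inv_mul_cancel₀ hc, one_smul]
      rw [h2]
      refine Submodule.smul_mem _ _ (Submodule.sub_mem _ ⟨_, rfl⟩
        (Submodule.sum_mem _ fun c' hc' => ?_))
      rcases lt_or_ge c' c with h | h
      · rw [h0 _ h, zero_smul]
        exact Submodule.zero_mem _
      · exact Submodule.smul_mem _ _
          (ih c' (lt_of_le_of_ne h (Finset.ne_of_mem_erase hc').symm))
  have hsurj : Function.Surjective ρ := by
    rw [← LinearMap.range_eq_top, eq_top_iff]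
    intro g _
    have : g = ∑ c, g c • Pi.single c (1 : F) := by
      ext c'
      simp [Finset.sum_apply, Pi.single_apply]
    rw [this]
    exact Submodule.sum_mem _ fun c _ => Submodule.smul_mem _ _ (hsingle c)
  have hcard : S.card = k := by
    have := (LinearEquiv.ofBijective ρ ⟨hinj, hsurj⟩).finrank_eq
    rw [hX, Module.finrank_fintype_fun_eq_card, Fintype.card_coe] at this
    exact this.symm
  let p : Fin k → Fin n := S.orderEmbOfFin hcard
  have hpS : ∀ i, p i ∈ S := fun i => S.orderEmbOfFin_mem hcard i
  have hSp : ∀ c ∈ S, ∃ i, p i = c := fun c hc => by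
    have : c ∈ Set.range (S.orderEmbOfFin hcard) := by
      rw [Finset.range_orderEmbOfFin]
      exact hc
    exact this
  have hrow : ∀ i, ∃ v ∈ X, ∀ j, v (p j) = if i = j then 1 else 0 := by
    intro i
    obtain ⟨v, hv⟩ := hsurj (Pi.single ⟨p i, hpS i⟩ 1)
    refine ⟨v.1, v.2, fun j => ?_⟩
    rw [← hρ v ⟨p j, hpS j⟩, hv, Pi.single_apply]
    refine if_congr ?_ rfl rfl
    rw [Subtype.mk.injEq, (S.orderEmbOfFin hcard).injective.eq_iff, eq_comm]
  choose A hAX hA using hrow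
  have hpiv : HasPivots p A := by
    refine ⟨(S.orderEmbOfFin hcard).strictMono, hA, fun i c hc => ?_⟩
    have hne : A i ≠ 0 := fun h => by
      have := hA i i
      rw [h, if_pos rfl] at this
      exact zero_ne_one this
    -- The leading position of row i is in S, hence a pivot column, and the only one at which this
    -- row does not vanish is its own.
    obtain ⟨c', hc', h0, hne'⟩ := hS _ (hAX i) hne
    obtain ⟨j, rfl⟩ := hSp c' hc'
    have : i = j := by
      by_contra hij
      exact hne' (by rw [hA, if_neg hij])
    exact h0 c (this ▸ hc)
  refine ⟨p, A, hpiv, Submodule.eq_of_le_of_finrank_eq ?_ ?_⟩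
  · rw [Submodule.span_le]
    rintro _ ⟨i, rfl⟩
    exact hAX i
  · exact hpiv.finrank_span.trans hX.symm

theorem RE_spec (X : Gr F n k) :
    (RE X).IsReducedRowEchelon ∧ Submodule.span F (Set.range fun i => RE X i) = X.1 := by
  obtain ⟨p, A, h, hs⟩ := exists_hasPivots_span_eq X
  exact Classical.epsilon_spec (p := fun A : Matrix (Fin k) (Fin n) F =>
    A.IsReducedRowEchelon ∧ Submodule.span F (Set.range fun i => A i) = X.1)
    ⟨A, h.isReducedRowEchelon, hs⟩

theorem exists_hasPivots_RE (X : Gr F n k) : ∃ p, HasPivots p (RE X) :=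
  exists_hasPivots_of_isReducedRowEchelon (RE_spec X).1 (by rw [(RE_spec X).2]; exact X.2)

theorem RE_injective : Function.Injective (RE : Gr F n k → Matrix (Fin k) (Fin n) F) := by
  intro X Y h
  exact Subtype.ext (by rw [← (RE_spec X).2, h, (RE_spec Y).2])

theorem HasPivots.exists_RE_eq {p : Fin k → Fin n} {A : Matrix (Fin k) (Fin n) F}
    (h : HasPivots p A) : ∃ X : Gr F n k, RE X = A := by
  let X : Gr F n k := ⟨Submodule.span F (Set.range fun i => A i), h.finrank_span⟩
  obtain ⟨p', h'⟩ := exists_hasPivots_RE X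
  exact ⟨X, (h'.unique h (RE_spec X).2).2⟩

end FerrersCoding

/-! ### Subspaces as pairs of a word and an entries vector -/

namespace FerrersCoding

/-- Turns a word into a function of the columns and an entries vector into a function of the dots.
-/
theorem exists_map_eq_of_nodup {α β : Type*} [Inhabited β] {l : List α} (hl : l.Nodup)
    {x : List β} (hx : x.length = l.length) : ∃ f : α → β, l.map f = x := by
  classical
  induction l generalizing x with
  | nil => exact ⟨fun _ => default, (List.eq_nil_of_length_eq_zero hx).symm⟩
  | cons a l ih =>
    rcases x with _ | ⟨b, x⟩
    · simp at hx
    obtain ⟨hal, hl⟩ := List.nodup_cons.1 hl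
    obtain ⟨f, rfl⟩ := ih hl (x := x) (by simpa using hx)
    refine ⟨Function.update f a b, ?_⟩
    rw [List.map_cons, Function.update_self]
    congr 1
    refine List.map_congr_left fun c hc => ?_
    have hca : c ≠ a := by
      rintro rfl
      exact hal hc
    rw [Function.update_of_ne hca]

variable {F : Type*} [Field F] {n k : ℕ}

section Pivots

variable (p : Fin k → Fin n)

open Classical in
/-- The word of the columns, read from right to left, with `true` for the columns `p i`. -/
noncomputable def pivotWord : List Bool :=
  (List.finRange n).reverse.map fun c => decide (∃ i, p i = c)

open Classical in
/-- The columns that are not among the columns `p i`, from right to left. -/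
noncomputable def nonpivots : List (Fin n) :=
  (List.finRange n).reverse.filter fun c => ¬ ∃ i, p i = c

/-- The rows with a dot in column `c`, from top to bottom. -/
def dotRows (c : Fin n) : List (Fin k) := (List.finRange k).filter fun i => p i < c

/-- The positions of the dots, column by column. -/
noncomputable def dots : List (Fin k × Fin n) :=
  (nonpivots p).flatMap fun c => (dotRows p c).map fun i => (i, c)

variable {p}

theorem mem_nonpivots {c : Fin n} : c ∈ nonpivots p ↔ ¬ ∃ i, p i = c := by
  simp [nonpivots]

theorem mem_dots {i : Fin k} {c : Fin n} :
    (i, c) ∈ dots p ↔ (¬ ∃ i, p i = c) ∧ p i < c := by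
  simp [dots, mem_nonpivots, dotRows]

theorem nodup_finRange_reverse : (List.finRange n).reverse.Nodup :=
  List.nodup_reverse.2 (List.nodup_finRange n)

theorem nodup_dots : (dots p).Nodup := by
  rw [dots, List.nodup_flatMap]
  constructor
  · intro c _
    exact ((List.nodup_finRange k).filter _).map fun i j h => (Prod.mk.inj h).1
  · have : (nonpivots p).Nodup := nodup_finRange_reverse.filter _
    refine this.imp fun {c c'} hne => ?_
    rw [Function.onFun, List.disjoint_left]
    rintro ⟨i, d⟩ h1 h2
    simp only [List.mem_map, Prod.mk.injEq] at h1 h2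
    obtain ⟨_, _, _, rfl⟩ := h1
    obtain ⟨_, _, _, h⟩ := h2
    exact hne h.symm

-- Each pivot column in `l` belongs to exactly one row. Membership is passed as a predicate because
-- the result is needed both for all columns and for those left of a given one.
open Classical in
theorem count_map_pivots (hp : Function.Injective p) {l : List (Fin n)} (hl : l.Nodup)
    (q : Fin n → Prop) (hq : ∀ c, c ∈ l ↔ q c) :
    (l.map fun c => decide (∃ i, p i = c)).count true =
      ((List.finRange k).filter fun i => q (p i)).length := by
  rw [List.count_eq_countP, List.countP_map, List.countP_eq_length_filter,
    ← List.toFinset_card_of_nodup (hl.filter _),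
    ← List.toFinset_card_of_nodup ((List.nodup_finRange k).filter _),
    ← Finset.card_image_of_injective _ hp]
  congr 1
  ext c
  simp only [List.mem_toFinset, List.mem_filter, hq, Function.comp_apply, beq_iff_eq,
    decide_eq_true_eq, Finset.mem_image, List.mem_finRange, true_and]
  constructor
  · rintro ⟨h, i, rfl⟩
    exact ⟨i, h, rfl⟩
  · rintro ⟨i, h, rfl⟩
    exact ⟨h, i, rfl⟩

theorem pivotWord_mem_words (hp : Function.Injective p) :
    pivotWord p ∈ words k (n - k) := by
  classical
  have h1 : (pivotWord p).count true = k := by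
    rw [pivotWord, count_map_pivots hp nodup_finRange_reverse (fun _ => True) (by simp)]
    simp
  have h2 : (pivotWord p).length = n := by simp [pivotWord]
  have h3 := List.count_true_add_count_false (pivotWord p)
  rw [mem_words]
  omega

theorem map_length_dotRows (hp : Function.Injective p) :
    (nonpivots p).map (fun c => (dotRows p c).length) = wordDiagram (pivotWord p) := by
  classical
  -- Generalized to decreasing lists closed under smaller columns: after the head c come exactly the
  -- columns left of c, so the pivots in the tail are those of the rows with a dot in column c.
  have key : ∀ l : List (Fin n), l.Pairwise (· > ·) → (∀ c ∈ l, ∀ c' < c, c' ∈ l) →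
      (l.filter fun c => ¬ ∃ i, p i = c).map (fun c => (dotRows p c).length) =
        wordDiagram (l.map fun c => decide (∃ i, p i = c)) := by
    intro l h1 h2
    induction l with
    | nil => rfl
    | cons c l ih =>
      rw [List.pairwise_cons] at h1
      have hmem : ∀ c', c' ∈ l ↔ c' < c := fun c' => by
        refine ⟨fun h => h1.1 c' h, fun h => ?_⟩
        have := h2 c (by simp) c' h
        rw [List.mem_cons] at this
        exact this.resolve_left h.ne
      have ih' := ih h1.2 fun c' hc' c'' hc'' =>
        (hmem c'').2 (hc''.trans ((hmem c').1 hc'))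
      by_cases hc : ∃ i, p i = c
      · rw [List.filter_cons_of_neg (by simpa using hc), List.map_cons, decide_eq_true hc,
          wordDiagram, ih']
      · rw [List.filter_cons_of_pos (by simpa using hc), List.map_cons, List.map_cons,
          decide_eq_false hc, wordDiagram, ih',
          count_map_pivots hp (h1.2.imp fun h => h.ne') (· < c) hmem]
        congr 2
        rw [dotRows]
        exact List.filter_congr fun i _ => decide_eq_decide.2 Iff.rfl
  refine key _ ?_ (by simp)
  rw [List.pairwise_reverse]
  exact List.pairwise_lt_finRange n

theorem length_dots (hp : Function.Injective p) :
    (dots p).length = (wordDiagram (pivotWord p)).sum := by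
  rw [← map_length_dotRows hp, dots, List.length_flatMap]
  simp

theorem pivotWord_injective {p p' : Fin k → Fin n} (hp : StrictMono p) (hp' : StrictMono p')
    (h : pivotWord p = pivotWord p') : p = p' := by
  classical
  rw [← hp.range_inj hp']
  ext c
  have := List.map_inj_left.1 h c (by simp)
  simpa using this

theorem exists_pivotWord_eq {w : List Bool} (hkn : k ≤ n) (hw : w ∈ words k (n - k)) :
    ∃ p : Fin k → Fin n, StrictMono p ∧ pivotWord p = w := by
  classical
  rw [mem_words] at hw
  have hlen := List.count_true_add_count_false w
  obtain ⟨f, hf⟩ := exists_map_eq_of_nodup (nodup_finRange_reverse (n := n)) (x := w)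
    (by simp; omega)
  let S : Finset (Fin n) := Finset.univ.filter fun c => f c = true
  have hS : S.card = k := by
    rw [← hw.1, ← hf, List.count_eq_countP, List.countP_map, List.countP_eq_length_filter,
      ← List.toFinset_card_of_nodup (nodup_finRange_reverse.filter _)]
    congr 1
    ext c
    simp [S]
  refine ⟨S.orderEmbOfFin hS, (S.orderEmbOfFin hS).strictMono, ?_⟩
  rw [← hf, pivotWord]
  refine List.map_congr_left fun c _ => ?_
  have h1 : c ∈ Set.range (S.orderEmbOfFin hS) ↔ f c = true := by
    rw [Finset.range_orderEmbOfFin]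
    simp [S]
  rw [Set.mem_range] at h1
  simp [h1]

end Pivots

/-! ### The bijection between subspaces and pairs of a word and an entries vector -/

/-- The columns with leading coefficients of the reduced row echelon form of `X`. -/
noncomputable def pivots (X : Gr F n k) : Fin k → Fin n := (exists_hasPivots_RE X).choose

theorem hasPivots_RE (X : Gr F n k) : HasPivots (pivots X) (RE X) :=
  (exists_hasPivots_RE X).choose_spec

theorem freeColumns_RE (X : Gr F n k) : freeColumns (RE X) = nonpivots (pivots X) := by
  simp only [freeColumns, nonpivots, (hasPivots_RE X).isLeadingEntry_iff]

theorem rowsWithDot_RE (X : Gr F n k) (c : Fin n) :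
    rowsWithDot (RE X) c = dotRows (pivots X) c := by
  rw [rowsWithDot, dotRows]
  refine List.filter_congr fun i _ => ?_
  simp [(hasPivots_RE X).isLeadingEntry_iff]

theorem diagram_eq_wordDiagram (X : Gr F n k) :
    diagram X = wordDiagram (pivotWord (pivots X)) := by
  rw [← map_length_dotRows (hasPivots_RE X).strictMono.injective, diagram, freeColumns_RE]
  simp only [rowsWithDot_RE]

theorem entries_eq_map (X : Gr F n k) :
    entries X = (dots (pivots X)).map fun d => RE X d.1 d.2 := by
  rw [entries, freeColumns_RE, dots, List.map_flatMap]
  simp only [rowsWithDot_RE, List.map_map]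
  rfl

theorem length_entries (X : Gr F n k) : (entries X).length = size X := by
  rw [entries_eq_map, List.length_map, length_dots (hasPivots_RE X).strictMono.injective, size,
    diagram_eq_wordDiagram]

theorem pivotWord_mem (X : Gr F n k) : pivotWord (pivots X) ∈ words k (n - k) :=
  pivotWord_mem_words (hasPivots_RE X).strictMono.injective

/-- The word fixes the pivots, these fix every matrix entry that is not a dot, and the entries
vector fixes the dots. -/
theorem eq_of_pivotWord_eq_of_entries_eq {X Y : Gr F n k}
    (hw : pivotWord (pivots X) = pivotWord (pivots Y)) (hx : entries X = entries Y) :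
    X = Y := by
  have hp := pivotWord_injective (hasPivots_RE X).strictMono (hasPivots_RE Y).strictMono hw
  rw [entries_eq_map, entries_eq_map, hp] at hx
  apply RE_injective
  have hX := hasPivots_RE X
  have hY := hasPivots_RE Y
  rw [hp] at hX
  ext i c
  by_cases hc : ∃ j, pivots Y j = c
  · obtain ⟨j, rfl⟩ := hc
    rw [hX.apply_pivot, hY.apply_pivot]
  · rcases lt_trichotomy (pivots Y i) c with h | h | h
    · exact List.map_inj_left.1 hx (i, c) (mem_dots.2 ⟨hc, h⟩)
    · exact (hc ⟨i, h⟩).elim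
    · rw [hX.apply_eq_zero i c h, hY.apply_eq_zero i c h]

theorem exists_pivotWord_eq_and_entries_eq {w : List Bool} {x : List F} (hkn : k ≤ n)
    (hw : w ∈ words k (n - k)) (hx : x.length = (wordDiagram w).sum) :
    ∃ X : Gr F n k, pivotWord (pivots X) = w ∧ entries X = x := by
  classical
  obtain ⟨p, hp, rfl⟩ := exists_pivotWord_eq hkn hw
  rw [← length_dots hp.injective] at hx
  have : Inhabited F := ⟨0⟩
  obtain ⟨f, rfl⟩ := exists_map_eq_of_nodup (nodup_dots (p := p)) hx
  let A : Matrix (Fin k) (Fin n) F := fun i c =>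
    if ∃ j, p j = c then (if p i = c then 1 else 0) else if p i < c then f (i, c) else 0
  have hA : HasPivots p A := by
    refine ⟨hp, fun i j => ?_, fun i c hc => ?_⟩
    · have : ∃ j', p j' = p j := ⟨j, rfl⟩
      simp only [A, if_pos this, hp.injective.eq_iff]
    · simp only [A, if_neg hc.ne', if_neg hc.not_gt, ite_self]
  obtain ⟨X, hX⟩ := hA.exists_RE_eq
  have hXp := hasPivots_RE X
  rw [hX] at hXp
  have hpp : pivots X = p := (hXp.unique hA rfl).1
  refine ⟨X, by rw [hpp], ?_⟩
  rw [entries_eq_map, hpp, hX]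
  refine List.map_congr_left ?_
  rintro ⟨i, c⟩ hic
  rw [mem_dots] at hic
  simp only [A, if_neg hic.1, if_pos hic.2]

/-! ### The index as an explicit sum -/

theorem length_diagram (X : Gr F n k) : (diagram X).length = n - k := by
  rw [diagram_eq_wordDiagram, length_wordDiagram, (mem_words.1 (pivotWord_mem X)).2]

theorem le_of_mem_diagram {X : Gr F n k} {c : ℕ} (h : c ∈ diagram X) : c ≤ k := by
  rw [diagram_eq_wordDiagram] at h
  exact (le_count_of_mem_wordDiagram h).trans_eq (mem_words.1 (pivotWord_mem X)).1

theorem sum_le_of_mem_words {a b : ℕ} {w : List Bool} (hw : w ∈ words a b) :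
    (wordDiagram w).sum ≤ a * b := by
  have := wordDiagram_sum_le w
  rwa [(mem_words.1 hw).1, (mem_words.1 hw).2] at this

theorem size_le (X : Gr F n k) : size X ≤ k * (n - k) := by
  rw [size, diagram_eq_wordDiagram]
  exact sum_le_of_mem_words (pivotWord_mem X)

variable {q : ℕ}

theorem one_lt_of_equiv (e : F ≃ Fin q) : 1 < q := by
  have := Fintype.ofEquiv _ e.symm
  have h := Fintype.one_lt_card (α := F)
  rwa [Fintype.card_congr e, Fintype.card_fin] at h

theorem value_lt (e : F ≃ Fin q) (x : List F) : value e x < q ^ x.length := by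
  rw [value]
  convert Nat.ofDigits_lt_base_pow_length (one_lt_of_equiv e)
    (l := (x.map fun a => (e a : ℕ)).reverse) ?_ using 2
  · simp
  · intro d hd
    simp only [List.mem_reverse, List.mem_map] at hd
    obtain ⟨a, -, rfl⟩ := hd
    exact (e a).2

theorem value_injective (e : F ≃ Fin q) {x y : List F} (hl : x.length = y.length)
    (h : value e x = value e y) : x = y := by
  have hd : ∀ x : List F, ∀ d ∈ (x.map fun a => (e a : ℕ)).reverse, d < q := by
    intro x d hd
    simp only [List.mem_reverse, List.mem_map] at hd
    obtain ⟨a, -, rfl⟩ := hd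
    exact (e a).2
  have := Nat.ofDigits_inj_of_len_eq (one_lt_of_equiv e) (by simp [hl]) (hd x) (hd y) h
  rw [List.reverse_inj] at this
  refine List.map_injective_iff.2 (fun a b hab => ?_) this
  exact e.injective (Fin.ext hab)

/-- The number of entries vectors of length `m` with value less than `v`. -/
theorem card_value_lt (e : F ≃ Fin q) {m v : ℕ} (hv : v ≤ q ^ m) :
    Nat.card {x : List F // x.length = m ∧ value e x < v} = v := by
  have := Fintype.ofEquiv _ e.symm
  have hcard : Fintype.card F = q := by rw [Fintype.card_congr e, Fintype.card_fin]
  -- Reading a vector as a number is injective between sets of equal size, hence every number below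
  -- q^m is attained.
  let g : List.Vector F m → Fin (q ^ m) := fun x =>
    ⟨value e x.1, (value_lt e x.1).trans_eq (by rw [x.2])⟩
  have hg : Function.Bijective g := by
    rw [Fintype.bijective_iff_injective_and_card]
    refine ⟨fun x y h => ?_, by rw [card_vector, hcard, Fintype.card_fin]⟩
    exact Subtype.ext (value_injective e (x.2.trans y.2.symm) (Fin.mk.inj h))
  have : Nat.card {x : List F // x.length = m ∧ value e x < v} = Nat.card (Fin v) := by
    refine Nat.card_congr (Equiv.ofBijective (fun x => ⟨value e x.1, x.2.2⟩) ⟨?_, ?_⟩)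
    · intro x y h
      exact Subtype.ext (value_injective e (x.2.1.trans y.2.1.symm) (Fin.mk.inj h))
    · rintro ⟨i, hi⟩
      obtain ⟨x, hx⟩ := hg.2 ⟨i, hi.trans_le hv⟩
      have hx' : value e x.1 = i := Fin.mk.inj hx
      exact ⟨⟨x.1, x.2, by omega⟩, Fin.ext hx'⟩
  rw [this, Nat.card_eq_fintype_card, Fintype.card_fin]

theorem card_length_eq (e : F ≃ Fin q) (m : ℕ) : Nat.card {x : List F // x.length = m} = q ^ m := by
  rw [← card_value_lt e le_rfl]
  refine Nat.card_congr (Equiv.subtypeEquivRight fun x => ?_)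
  constructor
  · rintro rfl
    exact ⟨rfl, value_lt e x⟩
  · exact fun h => h.1

/-- Counting subspaces word by word. -/
theorem card_gr_eq_sum (e : F ≃ Fin q) (hkn : k ≤ n) (Q : List Bool → List F → Prop) :
    Nat.card {Y : Gr F n k // Q (pivotWord (pivots Y)) (entries Y)} =
      ∑ w ∈ words k (n - k),
        Nat.card {x : List F // x.length = (wordDiagram w).sum ∧ Q w x} := by
  have := Fintype.ofEquiv _ e.symm
  have hfin : ∀ w : words k (n - k),
      Finite {x : List F // x.length = (wordDiagram w.1).sum ∧ Q w x} := fun w =>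
    Finite.of_injective (β := List.Vector F (wordDiagram w.1).sum) (fun x => ⟨x.1, x.2.1⟩)
      fun x y h => Subtype.ext (Subtype.mk.inj h)
  let g : {Y : Gr F n k // Q (pivotWord (pivots Y)) (entries Y)} →
      (Σ w : words k (n - k), {x : List F // x.length = (wordDiagram w.1).sum ∧ Q w x}) :=
    fun Y => ⟨⟨pivotWord (pivots Y.1), pivotWord_mem Y.1⟩, entries Y.1,
      by rw [length_entries, size, diagram_eq_wordDiagram], Y.2⟩
  have hg : Function.Bijective g := by
    constructor
    · intro X Y h
      have h1 : pivotWord (pivots X.1) = pivotWord (pivots Y.1) :=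
        congrArg (fun z => z.1.1) h
      have h2 : entries X.1 = entries Y.1 := congrArg (fun z => z.2.1) h
      exact Subtype.ext (eq_of_pivotWord_eq_of_entries_eq h1 h2)
    · rintro ⟨⟨w, hw⟩, x, hx, hQ⟩
      obtain ⟨X, rfl, rfl⟩ := exists_pivotWord_eq_and_entries_eq hkn hw hx
      exact ⟨⟨X, hQ⟩, rfl⟩
  rw [Nat.card_congr (Equiv.ofBijective g hg), Nat.card_sigma]
  exact Finset.sum_coe_sort (words k (n - k)) fun w =>
    Nat.card {x : List F // x.length = (wordDiagram w).sum ∧ Q w x}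

open Classical in
theorem Ind_eq_sum_words (e : F ≃ Fin q) (hkn : k ≤ n) (X : Gr F n k) :
    Ind e X = ∑ w ∈ words k (n - k),
      ((if size X < (wordDiagram w).sum then q ^ (wordDiagram w).sum else 0) +
        (if (wordDiagram w).sum = size X ∧ DiagramLT (wordDiagram w) (diagram X) then q ^ size X
          else 0) +
        if w = pivotWord (pivots X) then value e (entries X) else 0) := by
  let Q : List Bool → List F → Prop := fun w x =>
    size X < (wordDiagram w).sum ∨
    ((wordDiagram w).sum = size X ∧ DiagramLT (wordDiagram w) (diagram X)) ∨
    (wordDiagram w = diagram X ∧ value e x < value e (entries X))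
  have h0 : Ind e X = Nat.card {Y : Gr F n k // Q (pivotWord (pivots Y)) (entries Y)} := by
    rw [Ind]
    refine Nat.card_congr (Equiv.subtypeEquivRight fun Y => ?_)
    rw [Precedes, size.eq_1 Y, diagram_eq_wordDiagram Y]
  rw [h0, card_gr_eq_sum e hkn]
  refine Finset.sum_congr rfl fun w hw => ?_
  -- Makes the three conditions of the order exclusive, so each word contributes to at most one of
  -- the three summands.
  have hself : wordDiagram w = diagram X ↔ w = pivotWord (pivots X) := by
    rw [diagram_eq_wordDiagram]
    refine ⟨fun h => wordDiagram_injective ?_ h, fun h => by rw [h]⟩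
    rw [(mem_words.1 hw).1, (mem_words.1 (pivotWord_mem X)).1]
  by_cases h1 : size X < (wordDiagram w).sum
  · have h2 : ¬ ((wordDiagram w).sum = size X ∧ DiagramLT (wordDiagram w) (diagram X)) :=
      fun h => by omega
    have h3 : w ≠ pivotWord (pivots X) := fun h => by
      rw [← hself] at h
      rw [h, size] at h1
      omega
    rw [if_pos h1, if_neg h2, if_neg h3, ← card_length_eq e]
    exact Nat.card_congr (Equiv.subtypeEquivRight fun x => ⟨fun h => h.1, fun h => ⟨h, .inl h1⟩⟩)
  by_cases h2 : (wordDiagram w).sum = size X ∧ DiagramLT (wordDiagram w) (diagram X)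
  · have h3 : w ≠ pivotWord (pivots X) := fun h => by
      rw [← hself] at h
      rw [h] at h2
      obtain ⟨-, i, -, h⟩ := h2
      exact lt_irrefl _ h
    rw [if_neg h1, if_pos h2, if_neg h3, ← card_length_eq e, zero_add, add_zero, ← h2.1]
    exact Nat.card_congr (Equiv.subtypeEquivRight fun x =>
      ⟨fun h => h.1, fun h => ⟨h, .inr (.inl h2)⟩⟩)
  rw [if_neg h1, if_neg h2]
  by_cases h3 : w = pivotWord (pivots X)
  · rw [if_pos h3, zero_add, zero_add]
    have hs : (wordDiagram w).sum = size X := by rw [hself.2 h3, size]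
    have hv : value e (entries X) ≤ q ^ (wordDiagram w).sum := by
      rw [hs, ← length_entries]
      exact (value_lt e _).le
    rw [← card_value_lt e hv]
    refine Nat.card_congr (Equiv.subtypeEquivRight fun x => and_congr_right fun _ => ?_)
    simp only [Q, h1, h2, false_or]
    rw [hself]
    exact and_iff_right h3
  · rw [if_neg h3]
    simp only [Q, h1, h2, hself, h3, false_or, false_and, and_false]
    exact Nat.card_of_isEmpty

/-- The index through the numbers `boxCount`. -/
theorem Ind_eq (e : F ≃ Fin q) (hkn : k ≤ n) (X : Gr F n k) :
    Ind e X = ∑ i ∈ Finset.Icc (size X + 1) (k * (n - k)), boxCount k (n - k) i * q ^ i +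
      value e (entries X) + q ^ size X * diagramRank k (size X) (diagram X) := by
  classical
  rw [Ind_eq_sum_words e hkn, Finset.sum_add_distrib, Finset.sum_add_distrib,
    Finset.sum_ite_eq' (words k (n - k)), if_pos (pivotWord_mem X), ← Finset.sum_filter,
    ← Finset.sum_filter, Finset.sum_const, smul_eq_mul]
  have h1 : ∑ w ∈ words k (n - k) with size X < (wordDiagram w).sum, q ^ (wordDiagram w).sum =
      ∑ i ∈ Finset.Icc (size X + 1) (k * (n - k)), boxCount k (n - k) i * q ^ i := by
    -- The larger diagrams are grouped by their size i, and each group has `boxCount k (n - k) i`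
    -- members.
    rw [← Finset.sum_fiberwise_of_maps_to (t := Finset.Icc (size X + 1) (k * (n - k)))
      (g := fun w => (wordDiagram w).sum)]
    · refine Finset.sum_congr rfl fun i hi => ?_
      rw [← wordCount_sum_eq, wordCount_eq_card, Finset.filter_filter, ← smul_eq_mul,
        ← Finset.sum_const]
      refine Finset.sum_congr (Finset.filter_congr fun w _ => ?_) fun w hw => ?_
      · rw [Finset.mem_Icc] at hi
        omega
      · rw [(Finset.mem_filter.1 hw).2]
    · intro w hw
      rw [Finset.mem_filter] at hw
      rw [Finset.mem_Icc]
      exact ⟨hw.2, sum_le_of_mem_words hw.1⟩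
  have h2 := wordCount_DiagramLT (pivotWord_mem X)
  rw [← diagram_eq_wordDiagram, wordCount_eq_card] at h2
  have h3 : diagramRank k (size X) (diagram X) = _ := h2.symm
  rw [h1, h3, mul_comm (q ^ size X), add_right_comm]
  rfl

theorem Ind_eq_indexFormula (e : F ≃ Fin q) (hkn : k ≤ n) (X : Gr F n k) : Ind e X = indexFormula e X := by
  rw [Ind_eq e hkn, indexFormula]
  congr 1
  · simp only [boxPartitions_eq_boxCount]
  · rw [diagramRank_eq_sum k (size X) (diagram X) le_rfl, length_diagram, ← Finset.Ico_add_one_right_eq_Icc 1,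
      Finset.sum_Ico_eq_sum_range, Nat.add_sub_cancel]
    congr 1
    refine Finset.sum_congr rfl fun j hj => ?_
    have h1 : column X (1 + j) = (diagram X).getD j 0 := by
      rw [column, if_neg (by omega), Nat.add_sub_cancel_left]
    have h2 : column X (1 + j - 1) = if j = 0 then k else (diagram X).getD (j - 1) 0 := by
      rw [column, Nat.add_sub_cancel_left]
    rw [h1, h2]
    refine Finset.sum_congr rfl fun a _ => ?_
    have h3 : ∑ i ∈ Finset.Icc 1 (1 + j - 1), (column X i : ℤ) =
        ∑ i ∈ Finset.range j, ((diagram X).getD i 0 : ℤ) := by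
      rw [← Finset.Ico_add_one_right_eq_Icc, Finset.sum_Ico_eq_sum_range]
      refine Finset.sum_congr (by congr 1; omega) fun i _ => ?_
      rw [column, if_neg (by omega), Nat.add_sub_cancel_left]
    rw [h3, show n - k - (1 + j) = n - k - (j + 1) by omega]

/-- At most 2^n words contribute at most q^(k(n-k)) each. This crude bound fixes the width of the
result and excludes overflow in every partial sum. -/
theorem Ind_lt (e : F ≃ Fin q) (hk : 0 < k) (hkn : k < n) (X : Gr F n k) :
    Ind e X < q ^ (2 * (k * (n - k)) + 2) := by
  classical
  have hq := one_lt_of_equiv e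
  have hr := size_le X
  have hself : ∀ w ∈ words k (n - k), w = pivotWord (pivots X) →
      (wordDiagram w).sum = size X ∧ ¬ DiagramLT (wordDiagram w) (diagram X) := by
    rintro w - rfl
    rw [← diagram_eq_wordDiagram, size]
    exact ⟨rfl, fun ⟨i, _, h⟩ => lt_irrefl _ h⟩
  have h1 : Ind e X ≤ ∑ w ∈ words k (n - k), q ^ (k * (n - k)) := by
    rw [Ind_eq_sum_words e hkn.le]
    refine Finset.sum_le_sum fun w hw => ?_
    have h1 : q ^ (wordDiagram w).sum ≤ q ^ (k * (n - k)) :=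
      Nat.pow_le_pow_right (by omega) (sum_le_of_mem_words hw)
    have h2 : q ^ size X ≤ q ^ (k * (n - k)) := Nat.pow_le_pow_right (by omega) hr
    have h3 := value_lt e (entries X)
    rw [length_entries] at h3
    have h4 := hself w hw
    by_cases hc : w = pivotWord (pivots X)
    · rw [if_neg (by have := (h4 hc).1; omega), if_neg fun h => (h4 hc).2 h.2, if_pos hc]
      omega
    · rw [if_neg hc]
      by_cases ha : size X < (wordDiagram w).sum
      · rw [if_pos ha, if_neg (by omega)]
        exact h1
      · rw [if_neg ha]
        split_ifs <;> omega
  -- Equivalent to (k - 1)(n - k - 1) ≥ 0.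
  have h2 : k + (n - k) ≤ k * (n - k) + 1 := by
    obtain ⟨d, rfl⟩ := Nat.exists_eq_add_of_lt hkn
    obtain ⟨k, rfl⟩ := Nat.exists_eq_add_of_lt hk
    rw [show 0 + k + 1 + d + 1 - (0 + k + 1) = d + 1 by omega]
    nlinarith
  have h3 : (words k (n - k)).card ≤ q ^ (k * (n - k) + 1) :=
    (card_words_le _ _).trans ((Nat.pow_le_pow_right (by norm_num) h2).trans
      (Nat.pow_le_pow_left hq _))
  rw [Finset.sum_const, smul_eq_mul] at h1
  calc Ind e X ≤ _ := h1
    _ ≤ q ^ (k * (n - k) + 1) * q ^ (k * (n - k)) := Nat.mul_le_mul_right _ h3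
    _ = q ^ (2 * (k * (n - k)) + 1) := by rw [← pow_add]; congr 1; ring
    _ < _ := Nat.pow_lt_pow_right hq (by omega)

end FerrersCoding

/-! ### Reasoning about programs -/

namespace FerrersCoding

namespace Prog

/-- Whether a program writes the counter `c`. -/
def writesCounter (c : ℕ) : Prog → Bool
  | .seq P Q => P.writesCounter c || Q.writesCounter c
  | .zero x => x == c
  | .copy x _ => x == c
  | .succ x => x == c
  | .sub x _ _ => x == c
  | .load x _ => x == c
  | .ifLe _ _ P Q => P.writesCounter c || Q.writesCounter c
  | .ifCarry P Q => P.writesCounter c || Q.writesCounter c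
  | .ifDigitZero _ P Q => P.writesCounter c || Q.writesCounter c
  | .loop x _ P => x == c || P.writesCounter c
  | _ => false

/-- Whether a program writes the array `a` of digits. -/
def writesDigit (a : ℕ) : Prog → Bool
  | .seq P Q => P.writesDigit a || Q.writesDigit a
  | .digitZero D => D.array == a
  | .digitOne D => D.array == a
  | .digitCopy D _ => D.array == a
  | .digitAdd D _ _ => D.array == a
  | .ifLe _ _ P Q => P.writesDigit a || Q.writesDigit a
  | .ifCarry P Q => P.writesDigit a || Q.writesDigit a
  | .ifDigitZero _ P Q => P.writesDigit a || Q.writesDigit a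
  | .loop _ _ P => P.writesDigit a
  | _ => false

/-- Whether a program writes the array `a` of counters. -/
def writesTable (a : ℕ) : Prog → Bool
  | .seq P Q => P.writesTable a || Q.writesTable a
  | .store T _ => T.array == a
  | .ifLe _ _ P Q => P.writesTable a || Q.writesTable a
  | .ifCarry P Q => P.writesTable a || Q.writesTable a
  | .ifDigitZero _ P Q => P.writesTable a || Q.writesTable a
  | .loop _ _ P => P.writesTable a
  | _ => false

/-- The two memory contents agree on everything that `P` does not write. -/
structure Frame (P : Prog) (s s' : State) : Prop where
  counter : ∀ c, P.writesCounter c = false → s'.counter c = s.counter c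
  digit : ∀ a, P.writesDigit a = false → s'.digit a = s.digit a
  table : ∀ a, P.writesTable a = false → s'.table a = s.table a

theorem Frame.refl (P : Prog) (s : State) : P.Frame s s :=
  ⟨fun _ _ => rfl, fun _ _ => rfl, fun _ _ => rfl⟩

theorem Frame.trans {P Q : Prog} {s s' s'' : State} (h : P.Frame s s') (h' : Q.Frame s' s'') :
    (P.seq Q).Frame s s'' := by
  constructor
  · intro c hc
    simp only [writesCounter, Bool.or_eq_false_iff] at hc
    rw [h'.counter c hc.2, h.counter c hc.1]
  · intro c hc
    simp only [writesDigit, Bool.or_eq_false_iff] at hc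
    rw [h'.digit c hc.2, h.digit c hc.1]
  · intro c hc
    simp only [writesTable, Bool.or_eq_false_iff] at hc
    rw [h'.table c hc.2, h.table c hc.1]

theorem Frame.ite {P Q R : Prog} {s : State} {c : Prop} [Decidable c] {q : ℕ}
    (hP : P.Frame s (P.run q s).1) (hQ : Q.Frame s (Q.run q s).1)
    (h1 : ∀ c, R.writesCounter c = (P.writesCounter c || Q.writesCounter c))
    (h2 : ∀ c, R.writesDigit c = (P.writesDigit c || Q.writesDigit c))
    (h3 : ∀ c, R.writesTable c = (P.writesTable c || Q.writesTable c)) :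
    R.Frame s (if c then P.run q s else Q.run q s).1 := by
  constructor
  · intro c hc
    rw [h1, Bool.or_eq_false_iff] at hc
    split_ifs
    exacts [hP.counter c hc.1, hQ.counter c hc.2]
  · intro c hc
    rw [h2, Bool.or_eq_false_iff] at hc
    split_ifs
    exacts [hP.digit c hc.1, hQ.digit c hc.2]
  · intro c hc
    rw [h3, Bool.or_eq_false_iff] at hc
    split_ifs
    exacts [hP.table c hc.1, hQ.table c hc.2]

theorem Frame.loop_step {P : Prog} {s s' s'' : State} {x y i : ℕ}
    (h : (loop x y P).Frame s s') (h' : P.Frame (s'.setCounter x i) s'') :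
    (loop x y P).Frame s s'' := by
  constructor
  · intro c hc
    rw [← h.counter c hc]
    simp only [writesCounter, Bool.or_eq_false_iff, beq_eq_false_iff_ne] at hc
    rw [h'.counter c hc.2, State.setCounter]
    exact Function.update_of_ne hc.1.symm _ _
  · intro c hc
    rw [← h.digit c hc]
    exact h'.digit c hc
  · intro c hc
    rw [← h.table c hc]
    exact h'.table c hc

/-- The state and the number of steps after `N` passes through a loop. -/
def passes (q x : ℕ) (P : Prog) (s : State) (N : ℕ) : State × ℕ :=
  (List.range N).foldl (fun acc i =>
    ((P.run q (acc.1.setCounter x i)).1, acc.2 + (P.run q (acc.1.setCounter x i)).2 + 1)) (s, 1)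

theorem passes_zero (q x : ℕ) (P : Prog) (s : State) : passes q x P s 0 = (s, 1) := rfl

theorem passes_succ (q x : ℕ) (P : Prog) (s : State) (N : ℕ) :
    passes q x P s (N + 1) =
      ((P.run q ((passes q x P s N).1.setCounter x N)).1,
        (passes q x P s N).2 + (P.run q ((passes q x P s N).1.setCounter x N)).2 + 1) := by
  rw [passes, List.range_succ, List.foldl_append]
  rfl

theorem run_loop (q x y : ℕ) (P : Prog) (s : State) :
    (loop x y P).run q s = passes q x P s (s.counter y) := rfl

theorem frame_run (q : ℕ) (P : Prog) (s : State) : P.Frame s (P.run q s).1 := by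
  have hc : ∀ (P : Prog) (s : State) (x v : ℕ), P.writesCounter x = true →
      P.Frame s (s.setCounter x v) := by
    intro P s x v h
    refine ⟨fun c hc => ?_, fun _ _ => rfl, fun _ _ => rfl⟩
    have : c ≠ x := by
      rintro rfl
      rw [h] at hc
      cases hc
    exact Function.update_of_ne this _ _
  have hd : ∀ (P : Prog) (s : State) (D : Cell) (v : ℕ) (b : Bool),
      P.writesDigit D.array = true → P.Frame s { s.setDigit D v with carry := b } := by
    intro P s D v b h
    refine ⟨fun _ _ => rfl, fun a ha => ?_, fun _ _ => rfl⟩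
    have : a ≠ D.array := by
      rintro rfl
      rw [h] at ha
      cases ha
    exact Function.update_of_ne this _ _
  induction P generalizing s with
  | skip => exact Frame.refl _ _
  | seq P Q ihP ihQ => exact (ihP s).trans (ihQ _)
  | zero x => exact hc _ _ _ _ (by simp [writesCounter])
  | copy x y => exact hc _ _ _ _ (by simp [writesCounter])
  | succ x => exact hc _ _ _ _ (by simp [writesCounter])
  | sub x y z => exact hc _ _ _ _ (by simp [writesCounter])
  | load x T => exact hc _ _ _ _ (by simp [writesCounter])
  | store T x =>
    refine ⟨fun _ _ => rfl, fun _ _ => rfl, fun a ha => ?_⟩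
    have : a ≠ T.array := by
      rintro rfl
      simp [writesTable] at ha
    exact Function.update_of_ne this _ _
  | digitZero D => exact hd _ s D _ s.carry (by simp [writesDigit])
  | digitOne D => exact hd _ s D _ s.carry (by simp [writesDigit])
  | digitCopy D D' => exact hd _ s D _ s.carry (by simp [writesDigit])
  | digitAdd D D' D'' => exact hd _ s D _ _ (by simp [writesDigit])
  | clearCarry => exact ⟨fun _ _ => rfl, fun _ _ => rfl, fun _ _ => rfl⟩
  | ifLe x y P Q ihP ihQ =>
    exact Frame.ite (ihP s) (ihQ s) (fun _ => rfl) (fun _ => rfl) (fun _ => rfl)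
  | ifCarry P Q ihP ihQ =>
    exact Frame.ite (ihP s) (ihQ s) (fun _ => rfl) (fun _ => rfl) (fun _ => rfl)
  | ifDigitZero D P Q ihP ihQ =>
    exact Frame.ite (ihP s) (ihQ s) (fun _ => rfl) (fun _ => rfl) (fun _ => rfl)
  | loop x y P ih =>
    rw [run_loop]
    generalize s.counter y = N
    induction N with
    | zero => exact Frame.refl _ _
    | succ N ihN =>
      rw [passes_succ]
      exact ihN.loop_step (ih _)

/-! ### Hoare triples with a step bound -/

/-- Started in `s`, the program reaches a state with property `R` in at most `t` steps. -/
def Achieves (q : ℕ) (P : Prog) (t : ℕ) (s : State) (R : State → Prop) : Prop :=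
  R (P.run q s).1 ∧ (P.run q s).2 ≤ t

theorem Achieves.mono {q t t' : ℕ} {P : Prog} {s : State} {R R' : State → Prop}
    (h : P.Achieves q t s R) (ht : t ≤ t') (hR : ∀ s', P.Frame s s' → R s' → R' s') :
    P.Achieves q t' s R' :=
  ⟨hR _ (frame_run q P s) h.1, h.2.trans ht⟩

theorem Achieves.seq {q t t' : ℕ} {P Q : Prog} {s : State} {R R' : State → Prop}
    (hP : P.Achieves q t s R)
    (hQ : ∀ s', P.Frame s s' → R s' → Q.Achieves q t' s' R') :
    (P.seq Q).Achieves q (t + t') s R' := by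
  have h := hQ _ (frame_run q P s) hP.1
  exact ⟨h.1, add_le_add hP.2 h.2⟩

/-- One step for the entry and one extra per pass. The body may use the frame of the loop since its
entry, so the invariant `I` need only mention what the loop changes. -/
theorem Achieves.loop {q t x y : ℕ} {P : Prog} {s : State} (I : ℕ → State → Prop)
    (h0 : I 0 s)
    (hP : ∀ i < s.counter y, ∀ s', (Prog.loop x y P).Frame s s' → I i s' →
      P.Achieves q t (s'.setCounter x i) (I (i + 1))) :
    (Prog.loop x y P).Achieves q (1 + s.counter y * (t + 1)) s (I (s.counter y)) := by
  have key : ∀ N ≤ s.counter y, (Prog.loop x y P).Frame s (passes q x P s N).1 ∧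
      I N (passes q x P s N).1 ∧ (passes q x P s N).2 ≤ 1 + N * (t + 1) := by
    intro N
    induction N with
    | zero => exact fun _ => ⟨Frame.refl _ _, h0, by rw [passes_zero]; omega⟩
    | succ N ih =>
      intro hN
      obtain ⟨h1, h2, h3⟩ := ih (by omega)
      have h4 := hP N (by omega) _ h1 h2
      rw [passes_succ]
      refine ⟨h1.loop_step (frame_run q P _), h4.1, ?_⟩
      have := h4.2
      dsimp only
      rw [Nat.succ_mul]
      omega
  have := key _ le_rfl
  rw [Achieves, run_loop]
  exact this.2

end Prog

/-! ### Adding digit by digit -/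

/-- The carry into position `t` when `A` and `B` are added in base `q`. -/
def carryInto (q A B t : ℕ) : Bool := decide (q ^ t ≤ A % q ^ t + B % q ^ t)

theorem carryInto_zero (q A B : ℕ) : carryInto q A B 0 = false := by
  simp [carryInto, Nat.mod_one]

theorem digit_add {q : ℕ} (hq : 0 < q) (A B t : ℕ) :
    (A / q ^ t % q + B / q ^ t % q + (carryInto q A B t).toNat) % q = (A + B) / q ^ t % q := by
  have h : (carryInto q A B t).toNat = if q ^ t ≤ A % q ^ t + B % q ^ t then 1 else 0 := by
    rw [carryInto]
    split_ifs with hc <;> simp [hc]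
  rw [h, Nat.add_div (by positivity), Nat.add_mod, Nat.add_mod (A / q ^ t + B / q ^ t)]
  simp

/-- Splitting A and B at position t, the lower parts add up to the old carry times q^t plus a
remainder below q^t. -/
theorem carry_add {q : ℕ} (hq : 0 < q) (A B t : ℕ) :
    decide (q ≤ A / q ^ t % q + B / q ^ t % q + (carryInto q A B t).toNat) =
      carryInto q A B (t + 1) := by
  have hQ : 0 < q ^ t := by positivity
  have h : (carryInto q A B t).toNat = if q ^ t ≤ A % q ^ t + B % q ^ t then 1 else 0 := by
    rw [carryInto]
    split_ifs with hc <;> simp [hc]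
  rw [h, carryInto, decide_eq_decide, Nat.mod_pow_succ, Nat.mod_pow_succ, pow_succ]
  have hA := Nat.mod_lt A hQ
  have hB := Nat.mod_lt B hQ
  generalize A / q ^ t % q = a
  generalize B / q ^ t % q = b
  generalize A % q ^ t = A0 at *
  generalize B % q ^ t = B0 at *
  generalize q ^ t = Q at *
  -- A remainder below Q cannot decide the comparison of two multiples of Q.
  have key : ∀ x r : ℕ, r < Q → (q ≤ x ↔ Q * q ≤ Q * x + r) := by
    intro x r hr
    constructor
    · intro h
      have := Nat.mul_le_mul_left Q h
      omega
    · intro h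
      by_contra! hcon
      have := Nat.mul_le_mul_left Q (Nat.succ_le_of_lt hcon)
      rw [Nat.mul_succ] at this
      omega
  split_ifs with hc
  · rw [key (a + b + 1) (A0 + B0 - Q) (by omega)]
    have : Q * (a + b + 1) = Q * a + Q * b + Q := by ring
    omega
  · rw [key (a + b + 0) (A0 + B0) (by omega)]
    have : Q * (a + b + 0) = Q * a + Q * b := by ring
    omega

theorem digit_mul_pow {q : ℕ} (hq : 0 < q) (p c t : ℕ) :
    p * q ^ c / q ^ (c + t) % q = p / q ^ t % q := by
  rw [pow_add, mul_comm p, Nat.mul_div_mul_left _ _ (by positivity)]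

theorem digit_add_mul_pow_of_lt {q : ℕ} (hq : 0 < q) (N p : ℕ) {c t : ℕ} (h : t < c) :
    (N + p * q ^ c) / q ^ t % q = N / q ^ t % q := by
  obtain ⟨d, rfl⟩ := Nat.exists_eq_add_of_lt h
  have : p * q ^ (t + d + 1) = (p * q ^ d * q) * q ^ t := by ring
  rw [this, Nat.add_mul_div_right _ _ (by positivity), Nat.add_mul_mod_self_right]

/-- Adding p q^c may start at position c with the carry cleared. -/
theorem carryInto_mul_pow {q : ℕ} (hq : 0 < q) (N p c : ℕ) :
    carryInto q N (p * q ^ c) c = false := by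
  rw [carryInto, Nat.mul_mod_left, decide_eq_false_iff_not, add_zero, not_le]
  exact Nat.mod_lt _ (by positivity)

theorem digit_ofDigits {q : ℕ} {l : List ℕ} (hl : ∀ d ∈ l, d < q) (t : ℕ) :
    Nat.ofDigits q l / q ^ t % q = l.getD t 0 := by
  induction l generalizing t with
  | nil => simp
  | cons d l ih =>
    have hd : d < q := hl d (by simp)
    rw [Nat.ofDigits_cons]
    rcases t with _ | t
    · simp [Nat.add_mul_mod_self_left, Nat.mod_eq_of_lt hd]
    · rw [pow_succ', ← Nat.div_div_eq_div_mul, Nat.add_mul_div_left _ _ (by omega),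
        Nat.div_eq_of_lt hd, zero_add, ih (fun d hd => hl d (by simp [hd])),
        List.getD_cons_succ]

end FerrersCoding

/-! ### The parameters of the computation -/

namespace FerrersCoding

open Prog

/-- Counter `2` gets the number of free columns. -/
def freeProg : Prog := .sub 2 1 0

/-- Counter `3` gets the product of the counters `0` and `2`. -/
def areaProg : Prog := .loop 20 0 (.loop 21 2 (.succ 3))

/-- Counter `4` gets the square root of counter `3`, rounded up. -/
def sqrtProg : Prog :=
  .seq (.copy 9 3) <| .seq (.succ 10) <|
    .loop 20 3 (.ifLe 9 8 .skip
      (.seq (.sub 9 9 10) <| .seq (.succ 10) <| .seq (.succ 10) <| .succ 4))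

/-- Counter `5` gets the length of the numbers in the table. -/
def lengthProg : Prog :=
  .loop 20 4 (.seq (.succ 5) <| .seq (.succ 5) <| .seq (.succ 5) <| .seq (.succ 5) <| .succ 5)

/-- Counter `6` gets the length of the result. -/
def widthProg : Prog :=
  .seq (.succ 6) <| .seq (.succ 6) <| .loop 20 3 (.seq (.succ 6) <| .succ 6)

/-- Counter `7` gets the number of dots. -/
def sizeProg : Prog := .loop 20 2 (.seq (.load 21 ⟨0, [20]⟩) <| .loop 22 21 (.succ 7))

/-- Bounds of the loops. -/
def boundsProg : Prog :=
  .seq (.copy 11 0) <| .seq (.succ 11) <| .seq (.copy 12 2) <| .seq (.succ 12) <|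
    .seq (.copy 13 3) <| .seq (.succ 13) <| .succ 14

/-- The computation of all parameters. -/
def setupProg : Prog :=
  .seq freeProg <| .seq areaProg <| .seq sqrtProg <| .seq lengthProg <| .seq widthProg <|
    .seq sizeProg <| boundsProg

variable {q : ℕ}

theorem achieves_loop_succ (x y z : ℕ) (hxz : x ≠ z) (s : State) :
    (Prog.loop x y (.succ z)).Achieves q (1 + s.counter y * 2) s fun s' =>
      s'.counter z = s.counter z + s.counter y := by
  refine Achieves.loop (t := 1) (fun i s' => s'.counter z = s.counter z + i) rfl ?_
  intro i hi s' _ h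
  refine ⟨?_, le_rfl⟩
  simp only [Prog.run, State.setCounter, Function.update_self]
  rw [Function.update_of_ne hxz.symm, h, add_assoc]

theorem achieves_area {s : State} {k d : ℕ} (h0 : s.counter 0 = k) (h2 : s.counter 2 = d)
    (h3 : s.counter 3 = 0) :
    areaProg.Achieves q (1 + k * (1 + d * 2 + 1)) s fun s' => s'.counter 3 = k * d := by
  have := Achieves.loop (q := q) (t := 1 + d * 2) (x := 20) (y := 0)
    (P := .loop 21 2 (.succ 3)) (s := s) (fun i s' => s'.counter 3 = i * d) (by simpa using h3) ?_
  · rwa [h0] at this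
  intro i _ s' hf hi
  have h2' : (s'.setCounter 20 i).counter 2 = d := (hf.counter 2 rfl).trans h2
  have := achieves_loop_succ (q := q) 21 2 3 (by decide) (s'.setCounter 20 i)
  rw [h2'] at this
  refine this.mono le_rfl fun s'' _ h => ?_
  rw [h, Nat.succ_mul, ← hi]
  rfl

/-- Squares are sums of consecutive odd numbers: 1, 3, 5, … are subtracted from M until nothing is
left, and the subtractions are counted. -/
theorem achieves_sqrt {s : State} {M c : ℕ} (hM : 0 < M) (hc0 : 0 < c) (hc1 : M ≤ c ^ 2)
    (hc2 : (c - 1) ^ 2 < M) (h3 : s.counter 3 = M)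
    (h4 : s.counter 4 = 0) (h8 : s.counter 8 = 0) (h10 : s.counter 10 = 0) :
    sqrtProg.Achieves q (3 + M * 6) s fun s' => s'.counter 4 = c := by
  rw [show 3 + M * 6 = 1 + (1 + (1 + M * (5 + 1))) by ring]
  refine Achieves.seq (R := fun s' => s'.counter 9 = M)
    ⟨by simp [Prog.run, State.setCounter, h3], le_rfl⟩ fun s1 f1 h1 => ?_
  refine Achieves.seq (R := fun s' => s'.counter 10 = 1)
    ⟨by simp [Prog.run, State.setCounter, f1.counter 10 rfl, h10], le_rfl⟩ fun s2 f2 h2 => ?_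
  have g3 : s2.counter 3 = M := by rw [f2.counter 3 rfl, f1.counter 3 rfl, h3]
  have g4 : s2.counter 4 = 0 := by rw [f2.counter 4 rfl, f1.counter 4 rfl, h4]
  have g8 : s2.counter 8 = 0 := by rw [f2.counter 8 rfl, f1.counter 8 rfl, h8]
  have g9 : s2.counter 9 = M := by rw [f2.counter 9 rfl, h1]
  have := Achieves.loop (q := q) (t := 5) (x := 20) (y := 3) (P := .ifLe 9 8 .skip
      (.seq (.sub 9 9 10) <| .seq (.succ 10) <| .seq (.succ 10) <| .succ 4)) (s := s2)
    -- Counter 9 is the truncated remainder, counter 10 the next odd number. The last alternative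
    -- says that each pass either makes progress or comes after the end; M passes are enough since M
    -- ≤ M².
    (fun i s' => s'.counter 9 = M - s'.counter 4 ^ 2 ∧ s'.counter 10 = 2 * s'.counter 4 + 1 ∧
      (s'.counter 4 = 0 ∨ (s'.counter 4 - 1) ^ 2 < M) ∧ (i ≤ s'.counter 4 ∨ s'.counter 9 = 0))
    (by simp [g4, g9, h2]) ?_
  · rw [g3] at this
    refine this.mono le_rfl fun s' _ h => ?_
    obtain ⟨i1, i2, i3, i4⟩ := h
    have hM' : M ≤ s'.counter 4 ^ 2 := by
      rcases i4 with i4 | i4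
      · nlinarith
      · omega
    have hpos : 0 < s'.counter 4 := by
      by_contra! hcon
      rw [Nat.le_zero.1 hcon] at hM'
      omega
    have i5 := lt_of_pow_lt_pow_left₀ 2 (Nat.zero_le _) (hc2.trans_le hM')
    have i6 := lt_of_pow_lt_pow_left₀ 2 (Nat.zero_le _) ((i3.resolve_left hpos.ne').trans_le hc1)
    omega
  intro i _ s' hf ⟨i1, i2, i3, i4⟩
  have k8 : s'.counter 8 = 0 := by rw [hf.counter 8 rfl, g8]
  by_cases hz : s'.counter 9 = 0
  · refine ⟨?_, ?_⟩
    · simp [Prog.run, State.setCounter, hz, k8, i2, i3, ← i1]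
    · simp [Prog.run, State.setCounter, hz, k8]
  · refine ⟨?_, ?_⟩
    · simp only [Prog.run, State.setCounter, Function.update_apply, k8]
      norm_num [hz]
      generalize s'.counter 4 = c at *
      have hlt : c ^ 2 < M := by omega
      refine ⟨?_, by omega, hlt, by omega⟩
      rw [i1, i2, add_sq]
      omega
    · simp [Prog.run, State.setCounter, hz, k8]

theorem achieves_length {s : State} {c : ℕ} (h4 : s.counter 4 = c) (h5 : s.counter 5 = 0) :
    lengthProg.Achieves q (1 + c * 6) s fun s' => s'.counter 5 = 5 * c := by
  have := Achieves.loop (q := q) (t := 5) (x := 20) (y := 4) (P :=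
    .seq (.succ 5) <| .seq (.succ 5) <| .seq (.succ 5) <| .seq (.succ 5) <| .succ 5) (s := s)
    (fun i s' => s'.counter 5 = 5 * i) (by simpa using h5) ?_
  · rwa [h4] at this
  intro i _ s' _ h
  refine ⟨?_, by simp [Prog.run]⟩
  simp [Prog.run, State.setCounter, h]
  ring

theorem achieves_width {s : State} {M : ℕ} (h3 : s.counter 3 = M) (h6 : s.counter 6 = 0) :
    widthProg.Achieves q (3 + M * 3) s fun s' => s'.counter 6 = 2 * M + 2 := by
  rw [show 3 + M * 3 = 1 + (1 + (1 + M * (2 + 1))) by ring]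
  refine Achieves.seq (R := fun s' => s'.counter 6 = 1)
    ⟨by simp [Prog.run, State.setCounter, h6], le_rfl⟩ fun s1 f1 h1 => ?_
  refine Achieves.seq (R := fun s' => s'.counter 6 = 2)
    ⟨by simp [Prog.run, State.setCounter, h1], le_rfl⟩ fun s2 f2 h2 => ?_
  have g3 : s2.counter 3 = M := by rw [f2.counter 3 rfl, f1.counter 3 rfl, h3]
  have := Achieves.loop (q := q) (t := 2) (x := 20) (y := 3) (P := .seq (.succ 6) <| .succ 6)
    (s := s2) (fun i s' => s'.counter 6 = 2 * i + 2) (by simpa using h2) ?_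
  · rwa [g3] at this
  intro i _ s' _ h
  refine ⟨?_, by simp [Prog.run]⟩
  simp [Prog.run, State.setCounter, h]
  ring

theorem achieves_size {s : State} {k : ℕ} {D : List ℕ} (hD : ∀ c ∈ D, c ≤ k)
    (h2 : s.counter 2 = D.length) (h7 : s.counter 7 = 0) (hT : s.table 0 = listArray D) :
    sizeProg.Achieves q (1 + D.length * (k * 2 + 3)) s fun s' => s'.counter 7 = D.sum := by
  have := Achieves.loop (q := q) (t := 1 + (1 + k * 2)) (x := 20) (y := 2)
    (P := .seq (.load 21 ⟨0, [20]⟩) <| .loop 22 21 (.succ 7)) (s := s)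
    (fun i s' => s'.counter 7 = (D.take i).sum) (by simpa using h7) ?_
  · rw [h2, List.take_length] at this
    exact this.mono (by rw [show 1 + (1 + k * 2) + 1 = k * 2 + 3 by ring]) fun _ _ h => h
  intro i hi s' hf h
  rw [h2] at hi
  refine Achieves.seq (t := 1) (R := fun s'' => s''.counter 21 = D[i]) ⟨?_, le_rfl⟩
    fun s1 f1 h1 => ?_
  · simp [Prog.run, State.setCounter, State.address, hf.table 0 rfl, hT, listArray, hi]
  · have h21 : s1.counter 21 ≤ k := h1 ▸ hD _ (List.getElem_mem hi)
    refine (achieves_loop_succ 22 21 7 (by decide) s1).mono (by omega) fun s'' _ h'' => ?_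
    rw [h'', h1, f1.counter 7 rfl, List.take_add_one, List.sum_append, ← h]
    simp [hi, State.setCounter]

/-- The counters that hold the parameters. -/
structure Params (k d M L W r : ℕ) (s : State) : Prop where
  rows : s.counter 0 = k
  free : s.counter 2 = d
  area : s.counter 3 = M
  length : s.counter 5 = L
  width : s.counter 6 = W
  size : s.counter 7 = r
  zero : s.counter 8 = 0
  rows_succ : s.counter 11 = k + 1
  free_succ : s.counter 12 = d + 1
  area_succ : s.counter 13 = M + 1
  one : s.counter 14 = 1

theorem Params.of_frame {k d M L W r : ℕ} {s s' : State} (h : Params k d M L W r s) (P : Prog)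
    (hf : P.Frame s s')
    (hP : ∀ c ∈ [0, 2, 3, 5, 6, 7, 8, 11, 12, 13, 14], P.writesCounter c = false) :
    Params k d M L W r s' := by
  constructor
  · rw [hf.counter _ (hP _ (by simp)), h.rows]
  · rw [hf.counter _ (hP _ (by simp)), h.free]
  · rw [hf.counter _ (hP _ (by simp)), h.area]
  · rw [hf.counter _ (hP _ (by simp)), h.length]
  · rw [hf.counter _ (hP _ (by simp)), h.width]
  · rw [hf.counter _ (hP _ (by simp)), h.size]
  · rw [hf.counter _ (hP _ (by simp)), h.zero]
  · rw [hf.counter _ (hP _ (by simp)), h.rows_succ]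
  · rw [hf.counter _ (hP _ (by simp)), h.free_succ]
  · rw [hf.counter _ (hP _ (by simp)), h.area_succ]
  · rw [hf.counter _ (hP _ (by simp)), h.one]

/-- Counters from 15 on are scratch. -/
theorem Params.setCounter {k d M L W r : ℕ} {s : State} (h : Params k d M L W r s) {x : ℕ}
    (hx : 15 ≤ x) (v : ℕ) : Params k d M L W r (s.setCounter x v) := by
  have key : ∀ c, c < 15 → (s.setCounter x v).counter c = s.counter c := fun c hc =>
    Function.update_of_ne (by omega) _ _
  constructor <;> rw [key _ (by omega)]
  exacts [h.rows, h.free, h.area, h.length, h.width, h.size, h.zero, h.rows_succ, h.free_succ,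
    h.area_succ, h.one]

/-- The lengths 5c and 2k(n-k) + 2 are those of `boxCount_lt` and `Ind_lt`. As counters can only be
incremented, even a product is computed by counting, at cost O(k(n-k)). -/
theorem achieves_setup {s : State} {k n c : ℕ} {D : List ℕ} (hM : 0 < k * (n - k))
    (hc0 : 0 < c) (hc1 : k * (n - k) ≤ c ^ 2) (hc2 : (c - 1) ^ 2 < k * (n - k))
    (hD : ∀ c ∈ D, c ≤ k) (hl : D.length = n - k) (h0 : s.counter 0 = k)
    (h1 : s.counter 1 = n) (hz : ∀ c, 2 ≤ c → s.counter c = 0) (hT : s.table 0 = listArray D) :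
    setupProg.Achieves q (17 + 4 * k + 3 * (n - k) + 13 * (k * (n - k)) + 6 * c) s
      (Params k (n - k) (k * (n - k)) (5 * c) (2 * (k * (n - k)) + 2) D.sum) := by
  generalize hd : n - k = d at *
  have ht : 1 + ((1 + k * (1 + d * 2 + 1)) + ((3 + k * d * 6) + ((1 + c * 6) +
      ((3 + k * d * 3) + ((1 + D.length * (k * 2 + 3)) + 7))))) ≤
      17 + 4 * k + 3 * d + 13 * (k * d) + 6 * c := by
    have e1 : k * (1 + d * 2 + 1) = 2 * k + 2 * (k * d) := by ring
    have e2 : d * (k * 2 + 3) = 2 * (k * d) + 3 * d := by ring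
    have e3 : k * d * 6 = 6 * (k * d) := by ring
    have e4 : k * d * 3 = 3 * (k * d) := by ring
    rw [hl, e1, e2, e3, e4]
    omega
  generalize hMd : k * d = M at *
  refine Achieves.mono ?_ ht fun _ _ h => h
  refine Achieves.seq (R := fun s' => s'.counter 2 = d)
    ⟨by simp [freeProg, Prog.run, State.setCounter, h0, h1, hd], le_rfl⟩ fun s1 f1 g2 => ?_
  refine Achieves.seq (achieves_area (by rw [f1.counter 0 rfl, h0]) g2
    (by rw [f1.counter 3 rfl, hz _ (by omega)])) fun s2 f2 g3 => ?_
  rw [hMd] at g3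
  refine Achieves.seq (achieves_sqrt hM hc0 hc1 hc2 g3
    (by rw [f2.counter 4 rfl, f1.counter 4 rfl, hz _ (by omega)])
    (by rw [f2.counter 8 rfl, f1.counter 8 rfl, hz _ (by omega)])
    (by rw [f2.counter 10 rfl, f1.counter 10 rfl, hz _ (by omega)])) fun s3 f3 g4 => ?_
  refine Achieves.seq (achieves_length g4
    (by rw [f3.counter 5 rfl, f2.counter 5 rfl, f1.counter 5 rfl, hz _ (by omega)]))
    fun s4 f4 g5 => ?_
  refine Achieves.seq (achieves_width (by rw [f4.counter 3 rfl, f3.counter 3 rfl, g3])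
    (by rw [f4.counter 6 rfl, f3.counter 6 rfl, f2.counter 6 rfl, f1.counter 6 rfl,
      hz _ (by omega)])) fun s5 f5 g6 => ?_
  refine Achieves.seq (achieves_size hD
    (by rw [f5.counter 2 rfl, f4.counter 2 rfl, f3.counter 2 rfl, f2.counter 2 rfl, g2, hl])
    (by rw [f5.counter 7 rfl, f4.counter 7 rfl, f3.counter 7 rfl, f2.counter 7 rfl,
      f1.counter 7 rfl, hz _ (by omega)])
    (by rw [f5.table 0 rfl, f4.table 0 rfl, f3.table 0 rfl, f2.table 0 rfl, f1.table 0 rfl,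
      hT])) fun s6 f6 g7 => ?_
  have e0 : s6.counter 0 = k := by
    rw [f6.counter 0 rfl, f5.counter 0 rfl, f4.counter 0 rfl, f3.counter 0 rfl,
      f2.counter 0 rfl, f1.counter 0 rfl, h0]
  have e2 : s6.counter 2 = d := by
    rw [f6.counter 2 rfl, f5.counter 2 rfl, f4.counter 2 rfl, f3.counter 2 rfl,
      f2.counter 2 rfl, g2]
  have e3 : s6.counter 3 = M := by
    rw [f6.counter 3 rfl, f5.counter 3 rfl, f4.counter 3 rfl, f3.counter 3 rfl, g3]
  have e5 : s6.counter 5 = 5 * c := by rw [f6.counter 5 rfl, f5.counter 5 rfl, g5]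
  have e6 : s6.counter 6 = 2 * M + 2 := by rw [f6.counter 6 rfl, g6]
  have e8 : s6.counter 8 = 0 := by
    rw [f6.counter 8 rfl, f5.counter 8 rfl, f4.counter 8 rfl, f3.counter 8 rfl,
      f2.counter 8 rfl, f1.counter 8 rfl, hz _ (by omega)]
  have e14 : s6.counter 14 = 0 := by
    rw [f6.counter 14 rfl, f5.counter 14 rfl, f4.counter 14 rfl, f3.counter 14 rfl,
      f2.counter 14 rfl, f1.counter 14 rfl, hz _ (by omega)]
  refine ⟨?_, by simp [boundsProg, Prog.run]⟩
  constructor <;> simp [boundsProg, Prog.run, State.setCounter, *]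

end FerrersCoding

/-! ### The table of the numbers of partitions -/

namespace FerrersCoding

open Prog

/-- Addition of two numbers of the table. -/
def addProg : Prog :=
  .loop 27 5 (.digitAdd ⟨2, [21, 23, 25, 27]⟩ ⟨2, [20, 23, 25, 27]⟩ ⟨2, [21, 22, 26, 27]⟩)

/-- The recursion for one number of the table. -/
def cellProg : Prog :=
  .seq (.copy 25 24) <| .seq (.succ 25) <| .seq (.sub 26 25 20) <| .seq .clearCarry addProg

/-- The numbers of the table with two given indices. -/
def rowProg : Prog := .seq (.copy 23 22) <| .seq (.succ 23) <| .loop 24 13 cellProg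

/-- The numbers of the table with one given index. -/
def layerProg : Prog := .seq (.copy 21 20) <| .seq (.succ 21) <| .loop 22 12 rowProg

/-- The computation of the whole table. -/
def tableProg : Prog := .seq (.digitOne ⟨2, [8, 14, 14, 8]⟩) <| .loop 20 11 layerProg

variable {q : ℕ}

theorem State.setCounter_self (s : State) (x v : ℕ) : (s.setCounter x v).counter x = v :=
  Function.update_self _ _ _

/-- Digit array `2` holds the base-`q` digits of the numbers `C a η m`. -/
def Content (q : ℕ) (s : State) (C : ℕ → ℕ → ℕ → ℕ) : Prop :=
  ∀ a η m t, s.digit 2 [a, η, m, t] = C a η m / q ^ t % q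

/-- Only L digits are written: the target was 0 before and v < q^L, so all higher digits are already
right. -/
theorem achieves_cell (hq : 0 < q) {s : State} {a η m L v : ℕ} {C : ℕ → ℕ → ℕ → ℕ}
    (h20 : s.counter 20 = a) (h21 : s.counter 21 = a + 1) (h22 : s.counter 22 = η)
    (h23 : s.counter 23 = η + 1) (h24 : s.counter 24 = m) (h5 : s.counter 5 = L)
    (hC : Content q s C) (h0 : C (a + 1) (η + 1) (m + 1) = 0)
    (hv : C a (η + 1) (m + 1) + C (a + 1) η (m + 1 - a) = v) (hL : v < q ^ L) :
    cellProg.Achieves q (5 + 2 * L) s fun s' => Content q s' fun a' η' m' =>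
      if a' = a + 1 ∧ η' = η + 1 ∧ m' = m + 1 then v else C a' η' m' := by
  rw [show 5 + 2 * L = 1 + (1 + (1 + (1 + (1 + L * (1 + 1))))) by ring]
  refine Achieves.seq (R := fun s' => s'.counter 25 = m)
    ⟨by simp [Prog.run, State.setCounter, h24], le_rfl⟩ fun s1 f1 g25 => ?_
  refine Achieves.seq (R := fun s' => s'.counter 25 = m + 1)
    ⟨by simp [Prog.run, State.setCounter, g25], le_rfl⟩ fun s2 f2 g25 => ?_
  refine Achieves.seq (R := fun s' => s'.counter 26 = m + 1 - a)
    ⟨by simp [Prog.run, State.setCounter, g25, f2.counter 20 rfl, f1.counter 20 rfl, h20],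
      le_rfl⟩ fun s3 f3 g26 => ?_
  refine Achieves.seq (R := fun s' => s'.carry = false) ⟨rfl, le_rfl⟩ fun s4 f4 gc => ?_
  have e5 : s4.counter 5 = L := by
    rw [f4.counter 5 rfl, f3.counter 5 rfl, f2.counter 5 rfl, f1.counter 5 rfl, h5]
  have e20 : s4.counter 20 = a := by
    rw [f4.counter 20 rfl, f3.counter 20 rfl, f2.counter 20 rfl, f1.counter 20 rfl, h20]
  have e21 : s4.counter 21 = a + 1 := by
    rw [f4.counter 21 rfl, f3.counter 21 rfl, f2.counter 21 rfl, f1.counter 21 rfl, h21]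
  have e22 : s4.counter 22 = η := by
    rw [f4.counter 22 rfl, f3.counter 22 rfl, f2.counter 22 rfl, f1.counter 22 rfl, h22]
  have e23 : s4.counter 23 = η + 1 := by
    rw [f4.counter 23 rfl, f3.counter 23 rfl, f2.counter 23 rfl, f1.counter 23 rfl, h23]
  have e25 : s4.counter 25 = m + 1 := by rw [f4.counter 25 rfl, f3.counter 25 rfl, g25]
  have e26 : s4.counter 26 = m + 1 - a := by rw [f4.counter 26 rfl, g26]
  have hC4 : Content q s4 C := by
    intro a' η' m' t
    rw [f4.digit 2 rfl, f3.digit 2 rfl, f2.digit 2 rfl, f1.digit 2 rfl, hC]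
  have := Achieves.loop (q := q) (t := 1) (x := 27) (y := 5)
    (P := .digitAdd ⟨2, [21, 23, 25, 27]⟩ ⟨2, [20, 23, 25, 27]⟩ ⟨2, [21, 22, 26, 27]⟩) (s := s4)
    (fun i s' => (∀ a' η' m' t, s'.digit 2 [a', η', m', t] =
        if (a' = a + 1 ∧ η' = η + 1 ∧ m' = m + 1) ∧ t < i then v / q ^ t % q
        else C a' η' m' / q ^ t % q) ∧
      s'.carry = carryInto q (C a (η + 1) (m + 1)) (C (a + 1) η (m + 1 - a)) i)
    ⟨fun a' η' m' t => by rw [if_neg (by omega)]; exact hC4 a' η' m' t, by rw [gc, carryInto_zero]⟩ ?_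
  · rw [e5] at this
    refine this.mono le_rfl fun s' _ h a' η' m' t => ?_
    rw [h.1]
    dsimp only
    by_cases hidx : a' = a + 1 ∧ η' = η + 1 ∧ m' = m + 1
    · by_cases ht : t < L
      · rw [if_pos ⟨hidx, ht⟩, if_pos hidx]
      · rw [if_neg (fun h => ht h.2), if_pos hidx, hidx.1, hidx.2.1, hidx.2.2, h0,
          Nat.div_eq_of_lt (hL.trans_le (Nat.pow_le_pow_right hq (by omega))), Nat.zero_div]
    · rw [if_neg (fun h => hidx h.1), if_neg hidx]
  intro i _ s' hf ⟨hd, hc⟩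
  have k20 : s'.counter 20 = a := by rw [hf.counter 20 rfl, e20]
  have k21 : s'.counter 21 = a + 1 := by rw [hf.counter 21 rfl, e21]
  have k22 : s'.counter 22 = η := by rw [hf.counter 22 rfl, e22]
  have k23 : s'.counter 23 = η + 1 := by rw [hf.counter 23 rfl, e23]
  have k25 : s'.counter 25 = m + 1 := by rw [hf.counter 25 rfl, e25]
  have k26 : s'.counter 26 = m + 1 - a := by rw [hf.counter 26 rfl, e26]
  -- Neither summand is the cell being written: one differs from it in the first subscript, the
  -- other in the second.
  have r1 : s'.digit 2 [a, η + 1, m + 1, i] = C a (η + 1) (m + 1) / q ^ i % q := by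
    rw [hd, if_neg (by omega)]
  have r2 : s'.digit 2 [a + 1, η, m + 1 - a, i] = C (a + 1) η (m + 1 - a) / q ^ i % q := by
    rw [hd, if_neg (by omega)]
  refine ⟨⟨fun a' η' m' t => ?_, ?_⟩, le_rfl⟩
  · simp only [Prog.run, State.setDigit, State.getDigit, State.address, State.setCounter,
      List.map_cons, List.map_nil, Function.update_self, Function.update_apply, k20, k21, k22,
      k23, k25, k26, hc]
    norm_num [r1, r2]
    rw [digit_add hq, hv, hd]
    by_cases hidx : a' = a + 1 ∧ η' = η + 1 ∧ m' = m + 1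
    · rcases lt_trichotomy t i with ht | ht | ht
      · rw [if_neg (by omega), if_pos ⟨hidx, ht⟩, if_pos ⟨hidx, by omega⟩]
      · subst ht
        rw [if_pos (by omega), if_pos ⟨hidx, by omega⟩]
      · rw [if_neg (by omega), if_neg (by omega), if_neg (by omega)]
    · rw [if_neg (by omega), if_neg (by omega), if_neg (by omega)]
  · simp only [Prog.run, State.setDigit, State.getDigit, State.address, State.setCounter,
      List.map_cons, List.map_nil, Function.update_self, Function.update_apply, k20, k21, k22,
      k23, k25, k26, hc]
    norm_num [r1, r2]
    exact carry_add hq _ _ _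

/-- The numbers that the table holds when `a` layers, `b` rows of the next layer and `c` numbers
of the next row have been computed. -/
def filledTable (d M a b c : ℕ) (a' η' m' : ℕ) : ℕ :=
  if (a' ≤ a ∨ a' = a + 1 ∧ (η' ≤ b ∨ η' = b + 1 ∧ m' ≤ c)) ∧ η' ≤ d + 1 ∧ m' ≤ M + 1 then
    boxCell a' η' m' else 0

/-- Beginning the next row with no number computed only adds its cell with last index 0, which is 0
anyway. -/
theorem filledTable_row (d M a b : ℕ) :
    filledTable d M a b (M + 1) = filledTable d M a (b + 1) 0 := by
  funext a' η' m'
  rcases m' with _ | m'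
  · simp [filledTable, boxCell_zero_right]
  · rw [filledTable, filledTable]
    exact if_congr (by omega) rfl rfl

theorem filledTable_layer (d M a : ℕ) :
    filledTable d M a (d + 1) 0 = filledTable d M (a + 1) 0 0 := by
  funext a' η' m'
  rcases m' with _ | m'
  · simp [filledTable, boxCell_zero_right]
  rcases η' with _ | η'
  · simp [filledTable, boxCell_zero_middle]
  · rw [filledTable, filledTable]
    exact if_congr (by omega) rfl rfl

theorem filledTable_cell {d M a b c : ℕ} (hb : b ≤ d) (hc : c ≤ M) :
    (fun a' η' m' => if a' = a + 1 ∧ η' = b + 1 ∧ m' = c + 1 then boxCount a b c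
      else filledTable d M a b c a' η' m') = filledTable d M a b (c + 1) := by
  funext a' η' m'
  by_cases h : a' = a + 1 ∧ η' = b + 1 ∧ m' = c + 1
  · rw [if_pos h, filledTable, if_pos (by omega), h.1, h.2.1, h.2.2, boxCell_succ_succ_succ]
  · rw [if_neg h, filledTable, filledTable]
    exact if_congr (by omega) rfl rfl

theorem achieves_row (hq : 0 < q) {s : State} {k d M L W r a b : ℕ}
    (hp : Params k d M L W r s) (hb : b ≤ d)
    (hlt : ∀ m ≤ M, boxCount a b m < q ^ L)
    (h20 : s.counter 20 = a) (h21 : s.counter 21 = a + 1) (h22 : s.counter 22 = b)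
    (hC : Content q s (filledTable d M a b 0)) :
    rowProg.Achieves q (3 + (M + 1) * (6 + 2 * L)) s fun s' =>
      Content q s' (filledTable d M a (b + 1) 0) := by
  rw [show 3 + (M + 1) * (6 + 2 * L) = 1 + (1 + (1 + (M + 1) * (5 + 2 * L + 1))) by ring]
  refine Achieves.seq (R := fun s' => s'.counter 23 = b)
    ⟨by simp [Prog.run, State.setCounter, h22], le_rfl⟩ fun s1 f1 g23 => ?_
  refine Achieves.seq (R := fun s' => s'.counter 23 = b + 1)
    ⟨by simp [Prog.run, State.setCounter, g23], le_rfl⟩ fun s2 f2 g23 => ?_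
  have e13 : s2.counter 13 = M + 1 := by rw [f2.counter 13 rfl, f1.counter 13 rfl, hp.area_succ]
  have e5 : s2.counter 5 = L := by rw [f2.counter 5 rfl, f1.counter 5 rfl, hp.length]
  have e20 : s2.counter 20 = a := by rw [f2.counter 20 rfl, f1.counter 20 rfl, h20]
  have e21 : s2.counter 21 = a + 1 := by rw [f2.counter 21 rfl, f1.counter 21 rfl, h21]
  have e22 : s2.counter 22 = b := by rw [f2.counter 22 rfl, f1.counter 22 rfl, h22]
  have := Achieves.loop (q := q) (t := 5 + 2 * L) (x := 24) (y := 13) (P := cellProg) (s := s2)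
    (fun i s' => Content q s' (filledTable d M a b i)) ?_ ?_
  · rwa [e13, filledTable_row] at this
  · intro a' η' m' t
    rw [f2.digit 2 rfl, f1.digit 2 rfl, hC]
  intro i hi s' hf h
  rw [e13] at hi
  have := achieves_cell hq (s := s'.setCounter 24 i) (a := a) (η := b) (m := i) (L := L)
    (v := boxCount a b i) (C := filledTable d M a b i)
    ((hf.counter 20 rfl).trans e20) ((hf.counter 21 rfl).trans e21)
    ((hf.counter 22 rfl).trans e22) ((hf.counter 23 rfl).trans g23)
    (State.setCounter_self _ _ _) ((hf.counter 5 rfl).trans e5) h ?_ ?_ (hlt i (by omega))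
  · rwa [filledTable_cell hb (by omega)] at this
  · rw [filledTable, if_neg (by omega)]
  · rw [filledTable, if_pos (by omega), filledTable, if_pos (by omega), ← boxCell_succ,
      boxCell_succ_succ_succ]

theorem achieves_layer (hq : 0 < q) {s : State} {k d M L W r a : ℕ}
    (hp : Params k d M L W r s) (hlt : ∀ b ≤ d, ∀ m ≤ M, boxCount a b m < q ^ L)
    (h20 : s.counter 20 = a) (hC : Content q s (filledTable d M a 0 0)) :
    layerProg.Achieves q (3 + (d + 1) * (4 + (M + 1) * (6 + 2 * L))) s fun s' =>
      Content q s' (filledTable d M (a + 1) 0 0) := by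
  rw [show 3 + (d + 1) * (4 + (M + 1) * (6 + 2 * L)) =
    1 + (1 + (1 + (d + 1) * (3 + (M + 1) * (6 + 2 * L) + 1))) by ring]
  refine Achieves.seq (R := fun s' => s'.counter 21 = a)
    ⟨by simp [Prog.run, State.setCounter, h20], le_rfl⟩ fun s1 f1 g21 => ?_
  refine Achieves.seq (R := fun s' => s'.counter 21 = a + 1)
    ⟨by simp [Prog.run, State.setCounter, g21], le_rfl⟩ fun s2 f2 g21 => ?_
  have hp2 := (hp.of_frame _ f1 (by decide)).of_frame _ f2 (by decide)
  have e20 : s2.counter 20 = a := by rw [f2.counter 20 rfl, f1.counter 20 rfl, h20]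
  have := Achieves.loop (q := q) (t := 3 + (M + 1) * (6 + 2 * L)) (x := 22) (y := 12)
    (P := rowProg) (s := s2) (fun i s' => Content q s' (filledTable d M a i 0)) ?_ ?_
  · rwa [hp2.free_succ, filledTable_layer] at this
  · intro a' η' m' t
    rw [f2.digit 2 rfl, f1.digit 2 rfl, hC]
  intro i hi s' hf h
  rw [hp2.free_succ] at hi
  have hp3 := hp2.of_frame _ hf (by decide)
  exact achieves_row hq (s := s'.setCounter 22 i) (L := L) (W := W) (r := r) (k := k)
    (hp3.setCounter (by omega) _)
    (by omega) (hlt i (by omega)) ((hf.counter 20 rfl).trans e20)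
    ((hf.counter 21 rfl).trans g21) (State.setCounter_self _ _ _) h

theorem achieves_table (hq : 1 < q) {s : State} {k d M L W r : ℕ}
    (hp : Params k d M L W r s) (hlt : ∀ a ≤ k, ∀ b ≤ d, ∀ m ≤ M, boxCount a b m < q ^ L)
    (h2 : ∀ l, s.digit 2 l = 0) :
    tableProg.Achieves q (2 + (k + 1) * (4 + (d + 1) * (4 + (M + 1) * (6 + 2 * L)))) s fun s' =>
      Content q s' (filledTable d M (k + 1) 0 0) := by
  rw [show 2 + (k + 1) * (4 + (d + 1) * (4 + (M + 1) * (6 + 2 * L))) =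
    1 + (1 + (k + 1) * (3 + (d + 1) * (4 + (M + 1) * (6 + 2 * L)) + 1)) by ring]
  -- Counters 8 and 14 are the constants 0 and 1, so the digit set is the lowest one of cell (0, 1,
  -- 1), the only nonzero boundary value; the rest is the initial zero memory.
  refine Achieves.seq (R := fun s' => Content q s' (filledTable d M 0 0 0)) ⟨?_, le_rfl⟩
    fun s1 f1 hC => ?_
  · intro a' η' m' t
    simp only [Prog.run, State.setDigit, State.address, List.map_cons, List.map_nil,
      Function.update_self, Function.update_apply, hp.zero, hp.one, h2]
    rcases a' with _ | a'
    · rcases t with _ | t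
      · simp only [filledTable, boxCell, pow_zero, Nat.div_one]
        split_ifs <;> simp_all [Nat.mod_eq_of_lt]
      · have : 1 / q ^ (t + 1) = 0 := Nat.div_eq_of_lt (Nat.one_lt_pow (by omega) hq)
        have h1 : filledTable d M 0 0 0 0 η' m' / q ^ (t + 1) = 0 := by
          simp only [filledTable, boxCell]
          split_ifs <;> first | exact this | exact Nat.zero_div _
        simp [h1]
    · have : filledTable d M 0 0 0 (a' + 1) η' m' = 0 := by
        rcases m' with _ | m'
        · simp [filledTable, boxCell_zero_right]
        rcases η' with _ | η'
        · simp [filledTable, boxCell_zero_middle]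
        · rw [filledTable, if_neg (by omega)]
      simp [this]
  have hp1 := hp.of_frame _ f1 (by decide)
  have := Achieves.loop (q := q) (t := 3 + (d + 1) * (4 + (M + 1) * (6 + 2 * L))) (x := 20)
    (y := 11) (P := layerProg) (s := s1) (fun i s' => Content q s' (filledTable d M i 0 0)) hC ?_
  · rwa [hp1.rows_succ] at this
  intro i hi s' hf h
  rw [hp1.rows_succ] at hi
  have hp3 := hp1.of_frame _ hf (by decide)
  exact achieves_layer (by omega) (s := s'.setCounter 20 i) (L := L) (W := W) (r := r) (k := k)
    (hp3.setCounter (by omega) _)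
    (hlt i (by omega)) (State.setCounter_self _ _ _) h

end FerrersCoding

/-! ### Summation -/

namespace FerrersCoding

open Prog

/-- The digits of the entries vector become the first summand. -/
def copyProg : Prog :=
  .loop 20 7 (.seq (.sub 21 7 20) <| .seq (.sub 21 21 14) <| .digitCopy ⟨1, [20]⟩ ⟨0, [21]⟩)

/-- A number of the table, shifted by counter `31`, is added to the result. -/
def accProg : Prog :=
  .seq .clearCarry <|
    .loop 30 6 (.seq (.digitAdd ⟨1, [31]⟩ ⟨1, [31]⟩ ⟨2, [32, 33, 34, 30]⟩) <| .succ 31)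

/-- The arguments of a summand for a larger diagram. -/
def areaArgsProg : Prog :=
  .seq (.succ 21) <| .seq (.copy 31 21) <| .seq (.copy 34 21) <| .succ 34

/-- The preparation of the sum over the larger diagrams. -/
def areaInitProg : Prog :=
  .seq (.sub 15 3 7) <| .seq (.copy 21 7) <| .seq (.copy 32 11) <| .copy 33 12

/-- The sum over the larger diagrams. -/
def areaSumProg : Prog := .seq areaInitProg <| .loop 20 15 (.seq areaArgsProg accProg)

/-- The arguments of a summand for the diagrams of the same size. -/
def rankArgsProg : Prog :=
  .seq (.succ 23) <| .seq (.copy 32 23) <| .seq (.succ 32) <| .seq (.copy 33 18) <|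
    .seq (.copy 34 17) <| .seq (.succ 34) <| .seq (.sub 34 34 23) <| .copy 31 7

/-- The preparation of the sum for one column. -/
def columnInitProg : Prog :=
  .seq (.load 21 ⟨0, [20]⟩) <| .seq (.sub 22 16 21) <| .copy 23 21

/-- The transition to the next column. -/
def columnNextProg : Prog := .seq (.sub 17 17 21) <| .seq (.copy 16 21) <| .sub 18 18 14

/-- The sum for one column. -/
def columnProg : Prog :=
  .seq columnInitProg <| .seq (.loop 24 22 (.seq rankArgsProg accProg)) columnNextProg

/-- The preparation of the sum over the diagrams of the same size. -/
def rankInitProg : Prog := .seq (.copy 16 0) <| .seq (.copy 17 7) <| .copy 18 2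

/-- The sum over the diagrams of the same size. -/
def rankSumProg : Prog := .seq rankInitProg <| .loop 20 2 columnProg

variable {q : ℕ}

/-- The order is reversed, because x_1 is the most significant digit but cell 0 of the output is the
least significant one. -/
theorem achieves_copy {s : State} {k d M L W r : ℕ} {l : List ℕ} (hp : Params k d M L W r s)
    (hl : ∀ x ∈ l, x < q) (hr : l.length = r) (h0 : s.digit 0 = listArray l)
    (h1 : ∀ a, s.digit 1 a = 0) :
    copyProg.Achieves q (1 + r * 4) s fun s' => s'.HasOutput q (Nat.ofDigits q l.reverse) := by
  have := Achieves.loop (q := q) (t := 3) (x := 20) (y := 7)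
    (P := .seq (.sub 21 7 20) <| .seq (.sub 21 21 14) <| .digitCopy ⟨1, [20]⟩ ⟨0, [21]⟩) (s := s)
    (fun i s' => ∀ t, s'.digit 1 [t] = if t < i then l.reverse.getD t 0 else 0)
    (by simp [h1]) ?_
  · rw [hp.size] at this
    refine this.mono le_rfl fun s' _ h t => ?_
    rw [h, digit_ofDigits (by simpa using hl)]
    split_ifs with ht
    · rfl
    · rw [List.getD_eq_default _ _ (by rw [List.length_reverse]; omega)]
  intro i hi s' hf h
  rw [hp.size] at hi
  have hp' := hp.of_frame _ hf (by decide)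
  refine ⟨fun t => ?_, by simp [Prog.run]⟩
  have hd : s'.digit 0 = listArray l := by rw [hf.digit 0 rfl, h0]
  have h7 := hp'.size
  have h14 := hp'.one
  simp only [Prog.run, State.setDigit, State.getDigit, State.address, State.setCounter,
    List.map_cons, List.map_nil, Function.update_apply]
  norm_num [h7, h14, hd, listArray]
  rw [Function.update_apply, h]
  simp only [List.cons.injEq, and_true]
  rcases lt_trichotomy t i with ht | rfl | ht
  · rw [if_neg (by omega), if_pos ht, if_pos (by omega)]
    simp
  · rw [if_pos rfl, if_pos le_rfl, List.getElem?_reverse (by omega), hr,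
      show r - t - 1 = r - 1 - t by omega]
  · rw [if_neg (by omega), if_neg (by omega), if_neg (by omega)]

/-- The factor q^c costs nothing: the addition starts at position c of the result. It runs past the
top of the table entry to propagate the carry, and since the sum is below q^W it is complete after W
digits. -/
theorem achieves_acc (hq : 0 < q) {s : State} {W a η m c N p : ℕ} (h6 : s.counter 6 = W)
    (h31 : s.counter 31 = c) (h32 : s.counter 32 = a) (h33 : s.counter 33 = η)
    (h34 : s.counter 34 = m) (h2 : ∀ t, s.digit 2 [a, η, m, t] = p / q ^ t % q)
    (hN : s.HasOutput q N) (hlt : N + p * q ^ c < q ^ W) :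
    accProg.Achieves q (2 + W * 3) s fun s' => s'.HasOutput q (N + p * q ^ c) := by
  rw [show 2 + W * 3 = 1 + (1 + W * (2 + 1)) by ring]
  refine Achieves.seq (R := fun s' => s'.carry = false) ⟨rfl, le_rfl⟩ fun s1 f1 gc => ?_
  have e6 : s1.counter 6 = W := by rw [f1.counter 6 rfl, h6]
  have e31 : s1.counter 31 = c := by rw [f1.counter 31 rfl, h31]
  have e32 : s1.counter 32 = a := by rw [f1.counter 32 rfl, h32]
  have e33 : s1.counter 33 = η := by rw [f1.counter 33 rfl, h33]
  have e34 : s1.counter 34 = m := by rw [f1.counter 34 rfl, h34]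
  have eN : s1.HasOutput q N := fun t => by rw [f1.digit 1 rfl, hN]
  have e2 : ∀ t, s1.digit 2 [a, η, m, t] = p / q ^ t % q := fun t => by rw [f1.digit 2 rfl, h2]
  have := Achieves.loop (q := q) (t := 2) (x := 30) (y := 6)
    (P := .seq (.digitAdd ⟨1, [31]⟩ ⟨1, [31]⟩ ⟨2, [32, 33, 34, 30]⟩) <| .succ 31) (s := s1)
    (fun i s' => s'.counter 31 = c + i ∧ s'.carry = carryInto q N (p * q ^ c) (c + i) ∧
      ∀ t, s'.digit 1 [t] =
        if t < c + i then (N + p * q ^ c) / q ^ t % q else N / q ^ t % q) ?_ ?_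
  · rw [e6] at this
    refine this.mono le_rfl fun s' _ h t => ?_
    rw [h.2.2]
    split_ifs with ht
    · rfl
    · have hW : q ^ W ≤ q ^ t := Nat.pow_le_pow_right hq (by omega)
      rw [Nat.div_eq_of_lt (by omega), Nat.div_eq_of_lt (by omega)]
  · refine ⟨e31, by rw [gc, add_zero, carryInto_mul_pow hq], fun t => ?_⟩
    rw [eN]
    split_ifs with ht
    · rw [digit_add_mul_pow_of_lt hq _ _ (by omega)]
    · rfl
  intro i _ s' hf ⟨i1, i2, i3⟩
  have k32 : s'.counter 32 = a := by rw [hf.counter 32 rfl, e32]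
  have k33 : s'.counter 33 = η := by rw [hf.counter 33 rfl, e33]
  have k34 : s'.counter 34 = m := by rw [hf.counter 34 rfl, e34]
  have r1 : s'.digit 1 [c + i] = N / q ^ (c + i) % q := by rw [i3, if_neg (by omega)]
  have r2 : s'.digit 2 [a, η, m, i] = p * q ^ c / q ^ (c + i) % q := by
    rw [hf.digit 2 rfl, e2, digit_mul_pow hq]
  refine ⟨⟨?_, ?_, fun t => ?_⟩, by simp [Prog.run]⟩
  · simp [Prog.run, State.setDigit, State.setCounter, i1, add_assoc]
  · simp only [Prog.run, State.setDigit, State.getDigit, State.address, State.setCounter,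
      List.map_cons, List.map_nil, Function.update_self, Function.update_apply, k32, k33, k34,
      i1, i2]
    norm_num [r1, r2]
    exact carry_add hq _ _ _
  · simp only [Prog.run, State.setDigit, State.getDigit, State.address, State.setCounter,
      List.map_cons, List.map_nil, Function.update_self, Function.update_apply, k32, k33, k34,
      i1, i2]
    norm_num [r1, r2]
    rw [digit_add hq, i3]
    rcases lt_trichotomy t (c + i) with ht | ht | ht
    · rw [if_neg (by omega), if_pos ht, if_pos (by omega)]
    · rw [if_pos ht, ht, if_pos (by omega)]
    · rw [if_neg (by omega), if_neg (by omega), if_neg (by omega)]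

/-- The table has been computed. -/
def HasTable (q k d M : ℕ) (s : State) : Prop :=
  ∀ a ≤ k + 1, ∀ η ≤ d + 1, ∀ m ≤ M + 1, ∀ t, s.digit 2 [a, η, m, t] = boxCell a η m / q ^ t % q

theorem HasTable.of_frame {k d M : ℕ} {s s' : State} (h : HasTable q k d M s) {P : Prog}
    (hf : P.Frame s s') (hP : P.writesDigit 2 = false) : HasTable q k d M s' := by
  intro a ha η hη m hm t
  rw [hf.digit 2 hP, h a ha η hη m hm t]

theorem Content.hasTable {k d M : ℕ} {s : State}
    (h : Content q s (filledTable d M (k + 1) 0 0)) : HasTable q k d M s := by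
  intro a ha η hη m hm t
  rw [h, filledTable, if_pos (by omega)]

theorem HasOutput_of_frame {s s' : State} {N : ℕ} (h : s.HasOutput q N) {P : Prog}
    (hf : P.Frame s s') (hP : P.writesDigit 1 = false) : s'.HasOutput q N := by
  intro t
  rw [hf.digit 1 hP, h]

theorem achieves_areaSum (hq : 0 < q) {s : State} {k d M L W r N T : ℕ}
    (hp : Params k d M L W r s) (hT : HasTable q k d M s) (hN : s.HasOutput q N)
    (hsum : N + ∑ i ∈ Finset.range (M - r),
      boxCell (k + 1) (d + 1) (r + 1 + i + 1) * q ^ (r + 1 + i) = T) (hlt : T < q ^ W) :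
    areaSumProg.Achieves q (5 + M * (7 + W * 3)) s fun s' => s'.HasOutput q T := by
  have ht : 4 + (1 + (M - r) * (4 + (2 + W * 3) + 1)) ≤ 5 + M * (7 + W * 3) := by
    have := Nat.mul_le_mul_right (7 + W * 3) (Nat.sub_le M r)
    rw [show 4 + (2 + W * 3) + 1 = 7 + W * 3 by ring]
    omega
  refine Achieves.mono ?_ ht fun _ _ h => h
  refine Achieves.seq (R := fun s' => s'.counter 15 = M - r ∧ s'.counter 21 = r ∧
    s'.counter 32 = k + 1 ∧ s'.counter 33 = d + 1)
    ⟨by simp [areaInitProg, Prog.run, State.setCounter, hp.area, hp.size, hp.rows_succ,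
      hp.free_succ], by simp [areaInitProg, Prog.run]⟩ fun s1 f1 ⟨g15, g21, g32, g33⟩ => ?_
  have hp1 := hp.of_frame _ f1 (by decide)
  have hT1 := hT.of_frame f1 rfl
  have := Achieves.loop (q := q) (t := 4 + (2 + W * 3)) (x := 20) (y := 15)
    (P := .seq areaArgsProg accProg) (s := s1)
    (fun i s' => s'.counter 21 = r + i ∧ s'.HasOutput q (N + ∑ i ∈ Finset.range i,
      boxCell (k + 1) (d + 1) (r + 1 + i + 1) * q ^ (r + 1 + i)))
    ⟨g21, by simpa using HasOutput_of_frame hN f1 rfl⟩ ?_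
  · rw [g15, hsum] at this
    exact this.mono le_rfl fun s' _ h => h.2
  intro i hi s' hf ⟨i1, i2⟩
  rw [g15] at hi
  have hp' := hp1.of_frame _ hf (by decide)
  have k32 : s'.counter 32 = k + 1 := by rw [hf.counter 32 rfl, g32]
  have k33 : s'.counter 33 = d + 1 := by rw [hf.counter 33 rfl, g33]
  refine Achieves.seq (R := fun s' => s'.counter 21 = r + 1 + i ∧ s'.counter 31 = r + 1 + i ∧
    s'.counter 34 = r + 1 + i + 1) ⟨?_, by simp [areaArgsProg, Prog.run]⟩
    fun s2 f2 ⟨g21, g31, g34⟩ => ?_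
  · simp [areaArgsProg, Prog.run, State.setCounter, i1]
    omega
  have hp2 := (hp'.setCounter (x := 20) (by omega) i).of_frame _ f2 (by decide)
  have hT' : HasTable q k d M (s'.setCounter 20 i) :=
    (hT1.of_frame hf rfl : HasTable q k d M s')
  have hN' : (s'.setCounter 20 i).HasOutput q _ := i2
  -- All summands are nonnegative, so the bound on the final total covers each partial sum.
  have hle : N + ∑ j ∈ Finset.range i, boxCell (k + 1) (d + 1) (r + 1 + j + 1) * q ^ (r + 1 + j) +
      boxCell (k + 1) (d + 1) (r + 1 + i + 1) * q ^ (r + 1 + i) ≤ T := by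
    rw [add_assoc, ← Finset.sum_range_succ, ← hsum]
    gcongr
    omega
  refine (achieves_acc hq hp2.width g31 ((f2.counter 32 rfl).trans k32)
    ((f2.counter 33 rfl).trans k33) g34
    ((hT'.of_frame f2 rfl) _ le_rfl _ le_rfl _ (by omega))
    (HasOutput_of_frame hN' f2 rfl) (hle.trans_lt hlt)).mono le_rfl fun s3 f3 h => ⟨?_, ?_⟩
  · rw [f3.counter 21 rfl, g21]
    ring
  · rwa [add_assoc, ← Finset.sum_range_succ] at h

/-- Here c and b are the sizes of the previous and the current column, ρ the dots from the current
column on, and e the number of later columns. Counter 18 holds e + 1 because the table indices are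
shifted by one. -/
theorem achieves_column (hq : 0 < q) {s : State} {k d M L W r N j b c ρ e : ℕ} {D : List ℕ}
    (hp : Params k d M L W r s) (hT : HasTable q k d M s) (hN : s.HasOutput q N)
    (hD : s.table 0 = listArray D) (hb : D.getD j 0 = b) (h16 : s.counter 16 = c)
    (hc : c ≤ k) (h17 : s.counter 17 = ρ) (hρ : ρ ≤ M) (h18 : s.counter 18 = e + 1) (he : e ≤ d)
    (h20 : s.counter 20 = j)
    (hlt : N + (∑ i ∈ Finset.range (c - b),
      boxCell (b + 1 + i + 1) (e + 1) (ρ + 1 - (b + 1 + i))) * q ^ r < q ^ W) :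
    columnProg.Achieves q (7 + k * (11 + W * 3)) s fun s' =>
      s'.HasOutput q (N + (∑ i ∈ Finset.range (c - b),
        boxCell (b + 1 + i + 1) (e + 1) (ρ + 1 - (b + 1 + i))) * q ^ r) ∧
      s'.counter 16 = b ∧ s'.counter 17 = ρ - b ∧ s'.counter 18 = e := by
  have ht : 3 + ((1 + (c - b) * (8 + (2 + W * 3) + 1)) + 3) ≤ 7 + k * (11 + W * 3) := by
    have := Nat.mul_le_mul_right (11 + W * 3) ((Nat.sub_le c b).trans hc)
    rw [show 8 + (2 + W * 3) + 1 = 11 + W * 3 by ring]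
    omega
  refine Achieves.mono ?_ ht fun _ _ h => h
  refine Achieves.seq (R := fun s' => s'.counter 21 = b ∧ s'.counter 22 = c - b ∧
    s'.counter 23 = b) ⟨?_, by simp [columnInitProg, Prog.run]⟩ fun s1 f1 ⟨g21, g22, g23⟩ => ?_
  · rw [List.getD_eq_getElem?_getD] at hb
    simp [columnInitProg, Prog.run, State.setCounter, State.address, h20, hD, listArray, hb, h16]
  have hp1 := hp.of_frame _ f1 (by decide)
  have hT1 := hT.of_frame f1 rfl
  have hloop := Achieves.loop (q := q) (t := 8 + (2 + W * 3)) (x := 24) (y := 22)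
    (P := .seq rankArgsProg accProg) (s := s1)
    (fun i s' => s'.counter 23 = b + i ∧ s'.HasOutput q (N + (∑ i ∈ Finset.range i,
      boxCell (b + 1 + i + 1) (e + 1) (ρ + 1 - (b + 1 + i))) * q ^ r))
    ⟨g23, by simpa using HasOutput_of_frame hN f1 rfl⟩ ?_
  · rw [g22] at hloop
    refine Achieves.seq hloop fun s2 f2 ⟨_, h2⟩ => ⟨⟨?_, ?_, ?_, ?_⟩, ?_⟩
    · exact HasOutput_of_frame h2 (frame_run q columnNextProg s2) rfl
    · simp [columnNextProg, Prog.run, State.setCounter, f2.counter 21 rfl, g21]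
    · simp [columnNextProg, Prog.run, State.setCounter, f2.counter 21 rfl, g21,
        f2.counter 17 rfl, f1.counter 17 rfl, h17]
    · simp [columnNextProg, Prog.run, State.setCounter, f2.counter 18 rfl, f1.counter 18 rfl,
        h18, f2.counter 14 rfl, hp1.one]
    · simp [columnNextProg, Prog.run]
  intro i hi s' hf ⟨i1, i2⟩
  rw [g22] at hi
  have hp' := hp1.of_frame _ hf (by decide)
  have k17 : s'.counter 17 = ρ := by rw [hf.counter 17 rfl, f1.counter 17 rfl, h17]
  have k18 : s'.counter 18 = e + 1 := by rw [hf.counter 18 rfl, f1.counter 18 rfl, h18]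
  refine Achieves.seq (R := fun s' => s'.counter 23 = b + (i + 1) ∧
    s'.counter 32 = b + 1 + i + 1 ∧ s'.counter 33 = e + 1 ∧
    s'.counter 34 = ρ + 1 - (b + 1 + i) ∧ s'.counter 31 = r) ⟨?_, by simp [rankArgsProg, Prog.run]⟩
    fun s2 f2 ⟨g23, g32, g33, g34, g31⟩ => ?_
  · simp [rankArgsProg, Prog.run, State.setCounter, i1, k17, k18, hp'.size]
    omega
  have hp2 := (hp'.setCounter (x := 24) (by omega) i).of_frame _ f2 (by decide)
  have hT' : HasTable q k d M (s'.setCounter 24 i) :=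
    (hT1.of_frame hf rfl : HasTable q k d M s')
  have hN' : (s'.setCounter 24 i).HasOutput q _ := i2
  have hle : N + (∑ j ∈ Finset.range i, boxCell (b + 1 + j + 1) (e + 1) (ρ + 1 - (b + 1 + j))) *
      q ^ r + boxCell (b + 1 + i + 1) (e + 1) (ρ + 1 - (b + 1 + i)) * q ^ r ≤
      N + (∑ i ∈ Finset.range (c - b),
        boxCell (b + 1 + i + 1) (e + 1) (ρ + 1 - (b + 1 + i))) * q ^ r := by
    rw [add_assoc, ← add_mul, ← Finset.sum_range_succ]
    gcongr
    omega
  refine (achieves_acc hq hp2.width g31 g32 g33 g34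
    ((hT'.of_frame f2 rfl) _ (by omega) _ (by omega) _ (by omega))
    (HasOutput_of_frame hN' f2 rfl) (hle.trans_lt hlt)).mono le_rfl fun s3 f3 h => ⟨?_, ?_⟩
  · rw [f3.counter 23 rfl, g23]
  · rwa [add_assoc, ← add_mul, ← Finset.sum_range_succ] at h

theorem achieves_rankSum (hq : 0 < q) {s : State} {k d M L W r N T : ℕ} {D : List ℕ}
    (hp : Params k d M L W r s) (hT : HasTable q k d M s) (hN : s.HasOutput q N)
    (hD : s.table 0 = listArray D) (hl : D.length = d) (hk : ∀ c ∈ D, c ≤ k) (hr : r ≤ M)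
    (hsum : N + diagramRank k r D * q ^ r = T) (hlt : T < q ^ W) :
    rankSumProg.Achieves q (4 + d * (8 + k * (11 + W * 3))) s fun s' => s'.HasOutput q T := by
  rw [show 4 + d * (8 + k * (11 + W * 3)) = 3 + (1 + d * (7 + k * (11 + W * 3) + 1)) by ring]
  refine Achieves.seq (R := fun s' => s'.counter 16 = k ∧ s'.counter 17 = r ∧ s'.counter 18 = d)
    ⟨by simp [rankInitProg, Prog.run, State.setCounter, hp.rows, hp.size, hp.free],
      by simp [rankInitProg, Prog.run]⟩ fun s1 f1 ⟨g16, g17, g18⟩ => ?_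
  have hp1 := hp.of_frame _ f1 (by decide)
  have hT1 := hT.of_frame f1 rfl
  have := Achieves.loop (q := q) (t := 7 + k * (11 + W * 3)) (x := 20) (y := 2)
    (P := columnProg) (s := s1)
    -- As in tail recursion, the amount accumulated plus the rank still to be computed from the
    -- remaining columns is constant.
    (fun i s' => s'.counter 16 ≤ k ∧ s'.counter 17 ≤ M ∧ s'.counter 18 = d - i ∧
      ∃ N', s'.HasOutput q N' ∧
        N' + diagramRank (s'.counter 16) (s'.counter 17) (D.drop i) * q ^ r = T)
    ⟨g16.le, g17 ▸ hr, g18, N, HasOutput_of_frame hN f1 rfl, by rw [g16, g17]; exact hsum⟩ ?_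
  · rw [hp1.free] at this
    refine this.mono le_rfl fun s' _ ⟨_, _, _, N', h1, h2⟩ => ?_
    rw [← hl, List.drop_length, diagramRank, zero_mul, add_zero] at h2
    exact h2 ▸ h1
  intro i hi s' hf ⟨i1, i2, i3, N', i4, i5⟩
  rw [hp1.free] at hi
  have hp' := hp1.of_frame _ hf (by decide)
  have hT' : HasTable q k d M (s'.setCounter 20 i) :=
    (hT1.of_frame hf rfl : HasTable q k d M s')
  have hil : i < D.length := by omega
  rw [List.drop_eq_getElem_cons hil, diagramRank, add_mul, ← add_assoc, List.length_drop,
    show D.length - (i + 1) + 1 = d - (i + 1) + 1 by omega] at i5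
  refine (achieves_column (W := W) (L := L) (r := r) hq (hp'.setCounter (by omega) i) hT' (N := N') i4
    (D := D) (j := i) (b := D[i]) (c := s'.counter 16) (ρ := s'.counter 17) (e := d - (i + 1))
    ?_ (by simp [hil]) rfl i1 rfl i2 ?_ (by omega) (State.setCounter_self _ _ _) ?_).mono le_rfl
    fun s2 f2 ⟨h1, h2, h3, h4⟩ => ?_
  · exact (hf.table 0 rfl).trans ((f1.table 0 rfl).trans hD)
  · exact i3.trans (by omega)
  · omega
  · rw [h2, h3, h4]
    exact ⟨hk _ (List.getElem_mem hil), by omega, rfl, _, h1, i5⟩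

end FerrersCoding

/-! ### The whole program -/

namespace FerrersCoding

open Prog

/-- The computation of the index. -/
def indexProg : Prog :=
  .seq setupProg <| .seq tableProg <| .seq copyProg <| .seq areaSumProg rankSumProg

/-- The table dominates, with about k · d · kd numbers of 5c digits; everything else is O((kd)² +
c). -/
theorem indexTime_le {k d c r : ℕ} (hk : 0 < k) (hd : 0 < d) (hc : 0 < c) (hr : r ≤ k * d) :
    (17 + 4 * k + 3 * d + 13 * (k * d) + 6 * c) +
      ((2 + (k + 1) * (4 + (d + 1) * (4 + (k * d + 1) * (6 + 2 * (5 * c))))) +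
        ((1 + r * 4) + ((5 + k * d * (7 + (2 * (k * d) + 2) * 3)) +
          (4 + d * (8 + k * (11 + (2 * (k * d) + 2) * 3)))))) ≤
      300 * ((k * d) ^ 2 * c) := by
  have hM : 0 < k * d := Nat.mul_pos hk hd
  have hkM : k ≤ k * d := Nat.le_mul_of_pos_right k hd
  have hdM : d ≤ k * d := Nat.le_mul_of_pos_left d hk
  have h1 : (k + 1) * (4 + (d + 1) * (4 + (k * d + 1) * (6 + 2 * (5 * c)))) ≤
      152 * ((k * d) ^ 2 * c) := by
    have hMc : 0 < k * d * c := Nat.mul_pos hM hc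
    have a1 : (k * d + 1) * (6 + 2 * (5 * c)) ≤ (2 * (k * d)) * (16 * c) :=
      Nat.mul_le_mul (by omega) (by omega)
    have a2 : 4 + (k * d + 1) * (6 + 2 * (5 * c)) ≤ 36 * (k * d * c) := by
      have : (2 * (k * d)) * (16 * c) = 32 * (k * d * c) := by ring
      omega
    have a3 : (d + 1) * (4 + (k * d + 1) * (6 + 2 * (5 * c))) ≤ (2 * d) * (36 * (k * d * c)) :=
      Nat.mul_le_mul (by omega) a2
    have a4 : 4 + (d + 1) * (4 + (k * d + 1) * (6 + 2 * (5 * c))) ≤ 76 * (d * (k * d * c)) := by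
      have e : (2 * d) * (36 * (k * d * c)) = 72 * (d * (k * d * c)) := by ring
      have : 0 < d * (k * d * c) := Nat.mul_pos hd hMc
      omega
    calc _ ≤ (2 * k) * (76 * (d * (k * d * c))) := Nat.mul_le_mul (by omega) a4
      _ = _ := by ring
  have h2 : k * d * (7 + (2 * (k * d) + 2) * 3) = 13 * (k * d) + 6 * (k * d) ^ 2 := by ring
  have h3 : d * (8 + k * (11 + (2 * (k * d) + 2) * 3)) =
      8 * d + 17 * (k * d) + 6 * (k * d) ^ 2 := by ring
  rw [h2, h3]
  generalize k * d = M at *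
  have h4 : M ≤ M ^ 2 * c := by nlinarith [Nat.mul_pos hM hc]
  have h5 : M ^ 2 ≤ M ^ 2 * c := Nat.le_mul_of_pos_right _ hc
  have h6 : c ≤ M ^ 2 * c := Nat.le_mul_of_pos_left _ (by positivity)
  omega

theorem exists_rounded_sqrt {M : ℕ} (hM : 0 < M) :
    ∃ c, 0 < c ∧ M ≤ c ^ 2 ∧ (c - 1) ^ 2 < M := by
  refine ⟨Nat.sqrt (M - 1) + 1, by omega, ?_, ?_⟩
  · have := Nat.lt_succ_sqrt' (M - 1)
    rw [Nat.succ_eq_add_one] at this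
    omega
  · have := Nat.sqrt_le' (M - 1)
    rw [Nat.add_sub_cancel]
    omega

variable {F : Type*} [Field F] {n k q : ℕ}

theorem achieves_index (e : F ≃ Fin q) (hk : 0 < k) (hkn : k < n) (X : Gr F n k) {c : ℕ}
    (hc0 : 0 < c) (hc1 : k * (n - k) ≤ c ^ 2) (hc2 : (c - 1) ^ 2 < k * (n - k)) :
    indexProg.Achieves q (300 * ((k * (n - k)) ^ 2 * c)) (inputState e X) fun s =>
      s.HasOutput q (Ind e X) := by
  have hq := one_lt_of_equiv e
  have hd : 0 < n - k := by omega
  have hr := size_le X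
  refine Achieves.mono ?_ (indexTime_le hk hd hc0 hr) fun _ _ h => h
  refine Achieves.seq (achieves_setup (D := diagram X) (Nat.mul_pos hk hd) hc0 hc1 hc2
    (fun c hc => le_of_mem_diagram hc) (length_diagram X) rfl rfl (fun c hc => ?_) rfl)
    fun s1 f1 hp1 => ?_
  · simp only [inputState]
    rw [if_neg (by omega), if_neg (by omega)]
  refine Achieves.seq (achieves_table hq hp1 (fun a ha b hb m hm => ?_) fun l => ?_)
    fun s2 f2 hC => ?_
  -- The size bound is in powers of 2 and passes to base q because q ≥ 2.
  · exact (boxCount_lt c a b m hc0 (hm.trans hc1) ((Nat.mul_le_mul ha hb).trans hc1)).trans_le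
      (Nat.pow_le_pow_left hq _)
  · rw [f1.digit 2 rfl]
    rfl
  have hT2 := hC.hasTable
  have hp2 := hp1.of_frame _ f2 (by decide)
  refine Achieves.seq (achieves_copy (l := (entries X).map fun b => (e b : ℕ)) hp2 ?_ ?_ ?_ ?_)
    fun s3 f3 hN => ?_
  · intro x hx
    obtain ⟨b, -, rfl⟩ := List.mem_map.1 hx
    exact (e b).2
  · rw [List.length_map, length_entries, size]
  · rw [f2.digit 0 rfl, f1.digit 0 rfl]
    rfl
  · intro a
    rw [f2.digit 1 rfl, f1.digit 1 rfl]
    rfl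
  have hp3 := hp2.of_frame _ f3 (by decide)
  have hT3 := hT2.of_frame f3 rfl
  have hI := Ind_eq e hkn.le X
  have hlt := Ind_lt e hk hkn X
  have hsum : value e (entries X) + ∑ i ∈ Finset.range (k * (n - k) - size X),
      boxCell (k + 1) (n - k + 1) (size X + 1 + i + 1) * q ^ (size X + 1 + i) =
      ∑ i ∈ Finset.Icc (size X + 1) (k * (n - k)), boxCount k (n - k) i * q ^ i +
        value e (entries X) := by
    rw [← Finset.Ico_add_one_right_eq_Icc, Finset.sum_Ico_eq_sum_range, add_comm,
      show k * (n - k) + 1 - (size X + 1) = k * (n - k) - size X by omega]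
    simp only [boxCell_succ_succ_succ]
  refine Achieves.seq (achieves_areaSum (by omega) hp3 hT3 hN hsum (by omega)) fun s4 f4 hN4 => ?_
  have hp4 := hp3.of_frame _ f4 (by decide)
  have hT4 := hT3.of_frame f4 rfl
  refine achieves_rankSum (D := diagram X) (by omega) hp4 hT4 hN4 ?_ (length_diagram X)
    (fun c hc => le_of_mem_diagram hc) hr ?_ hlt
  · rw [f4.table 0 rfl, f3.table 0 rfl, f2.table 0 rfl, f1.table 0 rfl]
    rfl
  · rw [hI, mul_comm (q ^ size X)]
    rfl

/-- Rounding up costs at most a factor 2: c ≤ √M + 1 ≤ 2√M for M = k(n-k) ≥ 1. This turns 300 into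
600. -/
theorem indexTime_le_rpow (hk : 0 < k) (hkn : k < n) {c : ℕ}
    (hc2 : (c - 1) ^ 2 < k * (n - k)) :
    ((300 * ((k * (n - k)) ^ 2 * c) : ℕ) : ℝ) ≤
      600 * (k : ℝ) ^ (5 / 2 : ℝ) * ((n : ℝ) - (k : ℝ)) ^ (5 / 2 : ℝ) := by
  have hd : 0 < n - k := by omega
  have hM : 0 < k * (n - k) := Nat.mul_pos hk hd
  rw [mul_assoc, ← Nat.cast_sub hkn.le, ← Real.mul_rpow (by positivity) (by positivity),
    ← Nat.cast_mul]
  generalize k * (n - k) = M at *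
  have hM0 : (0 : ℝ) < M := by exact_mod_cast hM
  have h1 : (M : ℝ) ^ (5 / 2 : ℝ) = (M : ℝ) ^ 2 * Real.sqrt M := by
    rw [Real.sqrt_eq_rpow, ← Real.rpow_natCast, ← Real.rpow_add hM0]
    norm_num
  have h2 : (c : ℝ) ≤ 2 * Real.sqrt M := by
    have h3 : 1 ≤ Real.sqrt M := by
      rw [Real.one_le_sqrt]
      exact_mod_cast hM
    have h4 : ((c - 1 : ℕ) : ℝ) ≤ Real.sqrt M := by
      apply Real.le_sqrt_of_sq_le
      exact_mod_cast hc2.le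
    have h5 : (c : ℝ) ≤ ((c - 1 : ℕ) : ℝ) + 1 := by
      exact_mod_cast (by omega : c ≤ c - 1 + 1)
    linarith
  rw [h1]
  push_cast
  have := mul_le_mul_of_nonneg_left h2 (sq_nonneg (M : ℝ))
  linarith

end FerrersCoding

theorem mainTheorem6 :
    ∃ (P : FerrersCoding.Prog) (C : ℝ),
      ∀ (F : Type*) [Field F] (q : ℕ) (e : F ≃ Fin q) (n k : ℕ), 0 < k → k < n →
        ∀ X : FerrersCoding.Gr F n k,
          FerrersCoding.Ind e X = FerrersCoding.indexFormula e X ∧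
          (P.run q (FerrersCoding.inputState e X)).1.HasOutput q (FerrersCoding.Ind e X) ∧
          ((P.run q (FerrersCoding.inputState e X)).2 : ℝ) ≤
            C * (k : ℝ) ^ (5 / 2 : ℝ) * ((n : ℝ) - (k : ℝ)) ^ (5 / 2 : ℝ) := by
  refine ⟨FerrersCoding.indexProg, 600, fun F _ q e n k hk hkn X => ?_⟩
  obtain ⟨c, hc0, hc1, hc2⟩ :=
    FerrersCoding.exists_rounded_sqrt (Nat.mul_pos hk (Nat.sub_pos_of_lt hkn))
  have h := FerrersCoding.achieves_index e hk hkn X hc0 hc1 hc2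
  refine ⟨FerrersCoding.Ind_eq_indexFormula e hkn.le X, h.1, ?_⟩
  exact (Nat.cast_le.2 h.2).trans (FerrersCoding.indexTime_le_rpow hk hkn hc2)
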